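/- For $\alpha<\beta$ and $r_0\ge 0$ let $S=S(\alpha,\beta,r_0)=\{re^{i\theta}: r>r_0,\ \alpha<\theta<\beta\}\subset\mathbb C$. A function $f$ on $S$ is of order at most $\rho$ if for every $\rho'>\rho$ there is a constant $C(\rho')$ with $|f(z)|\le C(\rho')e^{|z|^{\rho'}}$ for all $z\in S$; its indicator of order $\rho$ is $h_{f,\rho}(\theta)=\limsup_{r\to\infty} r^{-\rho}\log|f(re^{i\theta})|\in[-\infty,+\infty]$ for $\alpha<\theta<\beta$. For $\rho>0$ let $\mathcal A$ be the algebra of all holomorphic functions $f$ on $S$ that are of order at most $\rho$ and satisfy $h_{f,\rho}(\theta)\le 0$ for $\alpha<\theta<\beta$. For $p$ holomorphic on $S$, the function $e^p$ is said to have almost sinusoidal indicator of order $\rho$ if $e^p$ and $e^{-p}$ are of order at most $\rho$ and there is a non-empty open interval $(\alpha_1,\beta_1)\subset(\alpha,\beta)$ such that $h_{e^{-p},\rho}(\theta)<0$ for $\theta\in(\alpha_1,\beta_1)$ and $h_{e^{p},\rho}(\theta)\le 0$ for all other $\theta\in(\alpha,\beta)$. Theorem. Let $\rho>0$, $r_0\ge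 0$ and $\beta-\alpha>\pi/\rho$, and let $\mathcal B$ be a (unital, complex) subalgebra of $\mathcal A$. Let $P\in\mathcal B[w]$ be a monic polynomial of degree $m\ge 1$, and let $f,p$ be holomorphic functions on $S$ such that $P(f)=e^p$ on $S$. If $e^p$ has almost sinusoidal indicator of order $\rho$, then there are $q\in\mathcal B$ and $\varepsilon\in\mathbb C$ with $\varepsilon^m=1$ such that $P(w)=(w+q)^m$ in $\mathcal B[w]$ and $f=\varepsilon e^{p/m}-q$ on $S$. -/

import Mathlib

namespace AngleEq

open Filter

noncomputable section

/-- The angle `S(α, β, r₀) = {r e^{iθ} : r > r₀, α < θ < β}`, as a subset of the plane. -/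
def sector (α β r₀ : ℝ) : Set ℂ :=
  {z | ∃ r θ : ℝ, r₀ < r ∧ α < θ ∧ θ < β ∧ z = (r : ℂ) * Complex.exp ((θ : ℂ) * Complex.I)}

/-- The function on the plane that equals `f` on `S` and `0` elsewhere; all notions below only
look at its values on `S`. -/
def extend {S : Set ℂ} (f : S → ℂ) : ℂ → ℂ := Function.extend Subtype.val f 0

/-- `f` is holomorphic on `S` (used for the open sets `S = S(α, β, r₀)` with `r₀ ≥ 0`). -/
def IsHolomorphic {S : Set ℂ} (f : S → ℂ) : Prop := DifferentiableOn ℂ (extend f) S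

/-- `f` is of order at most `ρ` on `S`: for every `ρ' > ρ` there is a constant `C` with
`|f(z)| ≤ C exp(|z|^ρ')` on `S`. -/
def OrderAtMost {S : Set ℂ} (f : S → ℂ) (ρ : ℝ) : Prop :=
  ∀ ρ' : ℝ, ρ < ρ' → ∃ C : ℝ, ∀ z : S, ‖f z‖ ≤ C * Real.exp (‖(z : ℂ)‖ ^ ρ')

/-- The indicator of `f` of order `ρ`: the limsup of `log |f(r e^{iθ})| / r^ρ` as `r → ∞`,
an extended real number, with `log 0 = -∞`. -/
def indicator {S : Set ℂ} (f : S → ℂ) (ρ θ : ℝ) : EReal :=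
  limsup (fun r : ℝ =>
    ENNReal.log ‖extend f ((r : ℂ) * Complex.exp ((θ : ℂ) * Complex.I))‖ₑ
      / ((r ^ ρ : ℝ) : EReal)) atTop

/-- Membership in the algebra of coefficients: holomorphic, of order at most `ρ`, with
nonpositive indicator of order `ρ` on `(α, β)`. -/
structure IsSlow {α β r₀ : ℝ} (ρ : ℝ) (f : sector α β r₀ → ℂ) : Prop where
  holo : IsHolomorphic f
  order : OrderAtMost f ρ
  ind : ∀ θ : ℝ, α < θ → θ < β → indicator f ρ θ ≤ 0

/-- The indicator of order `ρ` of the function `e^p` is almost sinusoidal. -/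
def AlmostSinusoidal {α β r₀ : ℝ} (ρ : ℝ) (p : sector α β r₀ → ℂ) : Prop :=
  OrderAtMost (fun z => Complex.exp (p z)) ρ ∧
  OrderAtMost (fun z => Complex.exp (-p z)) ρ ∧
  ∃ α₁ β₁ : ℝ, α₁ < β₁ ∧ Set.Ioo α₁ β₁ ⊆ Set.Ioo α β ∧
    (∀ θ ∈ Set.Ioo α₁ β₁, indicator (fun z => Complex.exp (-p z)) ρ θ < 0) ∧
    (∀ θ ∈ Set.Ioo α β \ Set.Ioo α₁ β₁, indicator (fun z => Complex.exp (p z)) ρ θ ≤ 0)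

theorem extend_apply {S : Set ℂ} (f : S → ℂ) (z : S) : extend f (z : ℂ) = f z :=
  Subtype.val_injective.extend_apply f 0 z

theorem isHolomorphic_congr {S : Set ℂ} {f : S → ℂ} {F : ℂ → ℂ} (hF : DifferentiableOn ℂ F S)
    (h : ∀ z : S, f z = F z) : IsHolomorphic f :=
  hF.congr fun z hz => (extend_apply f ⟨z, hz⟩).trans (h ⟨z, hz⟩)

theorem ray_mem {α β r₀ r θ : ℝ} (h1 : α < θ) (h2 : θ < β) (hr : r₀ < r) :
    (r : ℂ) * Complex.exp ((θ : ℂ) * Complex.I) ∈ sector α β r₀ :=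
  ⟨r, θ, hr, h1, h2, rfl⟩

theorem indicator_nonpos_iff {S : Set ℂ} (f : S → ℂ) (ρ θ : ℝ) :
    indicator f ρ θ ≤ 0 ↔ ∀ ε : ℝ, 0 < ε → ∀ᶠ r : ℝ in atTop,
      ‖extend f ((r : ℂ) * Complex.exp ((θ : ℂ) * Complex.I))‖ ≤ Real.exp (ε * r ^ ρ) := by
  have key : ∀ (w : ℂ) (r ε : ℝ), 0 < r →
      (ENNReal.log ‖w‖ₑ / ((r ^ ρ : ℝ) : EReal) ≤ (ε : EReal) ↔
        ‖w‖ ≤ Real.exp (ε * r ^ ρ)) := by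
    intro w r ε hr
    have hp : (0 : ℝ) < r ^ ρ := Real.rpow_pos_of_pos hr ρ
    rw [EReal.div_le_iff_le_mul (by exact_mod_cast hp) (EReal.coe_ne_top _), ← EReal.coe_mul,
      ← EReal.log_exp ((r ^ ρ * ε : ℝ) : EReal), ENNReal.log_le_log_iff, EReal.exp_coe,
      ← ofReal_norm, ENNReal.ofReal_le_ofReal_iff (Real.exp_pos _).le, mul_comm]
  constructor
  · intro h ε hε
    have h1 := eventually_lt_of_limsup_lt (lt_of_le_of_lt h (by exact_mod_cast hε :
      (0 : EReal) < (ε : EReal)))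
    filter_upwards [h1, eventually_gt_atTop 0] with r hr h0
    exact (key _ r ε h0).1 hr.le
  · intro h
    refine EReal.le_of_forall_lt_iff_le.1 fun ε hε => ?_
    refine limsup_le_of_le (by isBoundedDefault) ?_
    filter_upwards [h ε (by exact_mod_cast hε), eventually_gt_atTop 0] with r hr h0
    exact (key _ r ε h0).2 hr

theorem IsSlow.const {α β r₀ ρ : ℝ} (hρ : 0 < ρ) (c : ℂ) :
    IsSlow (α := α) (β := β) (r₀ := r₀) ρ (fun _ => c) where
  holo := isHolomorphic_congr (F := fun _ => c) (by fun_prop) fun _ => rfl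
  order := fun ρ' _ => ⟨‖c‖, fun z => le_mul_of_one_le_right (norm_nonneg _)
    (Real.one_le_exp (Real.rpow_nonneg (norm_nonneg _) _))⟩
  ind := fun θ h1 h2 => by
    refine (indicator_nonpos_iff _ _ _).2 fun ε hε => ?_
    have ht : Tendsto (fun r : ℝ => Real.exp (ε * r ^ ρ)) atTop atTop :=
      Real.tendsto_exp_atTop.comp ((tendsto_rpow_atTop hρ).const_mul_atTop hε)
    filter_upwards [ht.eventually_ge_atTop ‖c‖, eventually_gt_atTop r₀] with r hr h0
    exact (congrArg norm (extend_apply _ ⟨_, ray_mem h1 h2 h0⟩)).le.trans hr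

theorem IsSlow.add {α β r₀ ρ : ℝ} (hρ : 0 < ρ) {f g : sector α β r₀ → ℂ}
    (hf : IsSlow ρ f) (hg : IsSlow ρ g) : IsSlow ρ (f + g) where
  holo := isHolomorphic_congr (hf.holo.add hg.holo) fun z => by
    simp [extend_apply]
  order := fun ρ' h => by
    obtain ⟨C, hC⟩ := hf.order ρ' h
    obtain ⟨D, hD⟩ := hg.order ρ' h
    exact ⟨C + D, fun z => (norm_add_le _ _).trans (by linarith [hC z, hD z])⟩
  ind := fun θ h1 h2 => by
    refine (indicator_nonpos_iff _ _ _).2 fun ε hε => ?_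
    have hf' := (indicator_nonpos_iff _ _ _).1 (hf.ind θ h1 h2) (ε / 2) (half_pos hε)
    have hg' := (indicator_nonpos_iff _ _ _).1 (hg.ind θ h1 h2) (ε / 2) (half_pos hε)
    have ht : Tendsto (fun r : ℝ => Real.exp (ε / 2 * r ^ ρ)) atTop atTop :=
      Real.tendsto_exp_atTop.comp ((tendsto_rpow_atTop hρ).const_mul_atTop (half_pos hε))
    filter_upwards [hf', hg', ht.eventually_ge_atTop 2, eventually_gt_atTop r₀]
      with r hr1 hr2 hr3 h0
    have hm := ray_mem h1 h2 h0
    have e : ∀ u : sector α β r₀ → ℂ, extend u _ = u ⟨_, hm⟩ := fun u => extend_apply u ⟨_, hm⟩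
    rw [e] at hr1 hr2 ⊢
    have he : Real.exp (ε * r ^ ρ) = Real.exp (ε / 2 * r ^ ρ) * Real.exp (ε / 2 * r ^ ρ) := by
      rw [← Real.exp_add]; ring_nf
    refine (norm_add_le _ _).trans ?_
    rw [he]
    nlinarith

theorem IsSlow.mul {α β r₀ ρ : ℝ} (hρ : 0 < ρ) {f g : sector α β r₀ → ℂ}
    (hf : IsSlow ρ f) (hg : IsSlow ρ g) : IsSlow ρ (f * g) where
  holo := isHolomorphic_congr (hf.holo.mul hg.holo) fun z => by
    simp [extend_apply]
  order := fun ρ' h => by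
    obtain ⟨σ, hσ, hσ'⟩ := exists_between h
    obtain ⟨C, hC⟩ := hf.order σ hσ
    obtain ⟨D, hD⟩ := hg.order σ hσ
    have ht : Tendsto (fun r : ℝ => r ^ (ρ' - σ)) atTop atTop :=
      tendsto_rpow_atTop (sub_pos.2 hσ')
    obtain ⟨R, hR⟩ := eventually_atTop.1 ((ht.eventually_ge_atTop 2).and (eventually_gt_atTop 0))
    have hσ0 : 0 ≤ σ := (hρ.trans hσ).le
    refine ⟨|C| * |D| * Real.exp (2 * |R| ^ σ), fun z => ?_⟩
    have hz := norm_nonneg (z : ℂ)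
    have hb : 2 * ‖(z : ℂ)‖ ^ σ ≤ 2 * |R| ^ σ + ‖(z : ℂ)‖ ^ ρ' := by
      rcases le_total R ‖(z : ℂ)‖ with hz' | hz'
      · obtain ⟨h2, h3⟩ := hR _ hz'
        have e : ‖(z : ℂ)‖ ^ ρ' = ‖(z : ℂ)‖ ^ (ρ' - σ) * ‖(z : ℂ)‖ ^ σ := by
          rw [← Real.rpow_add h3]; ring_nf
        have := Real.rpow_nonneg hz σ
        have := Real.rpow_nonneg (abs_nonneg R) σ
        rw [e]
        nlinarith
      · have := Real.rpow_le_rpow hz (hz'.trans (le_abs_self R)) hσ0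
        have := Real.rpow_nonneg hz ρ'
        linarith
    have hE := Real.exp_pos (‖(z : ℂ)‖ ^ σ)
    have h1 : ‖f z‖ ≤ |C| * Real.exp (‖(z : ℂ)‖ ^ σ) :=
      (hC z).trans (mul_le_mul_of_nonneg_right (le_abs_self C) hE.le)
    have h2 : ‖g z‖ ≤ |D| * Real.exp (‖(z : ℂ)‖ ^ σ) :=
      (hD z).trans (mul_le_mul_of_nonneg_right (le_abs_self D) hE.le)
    calc ‖(f * g) z‖ = ‖f z‖ * ‖g z‖ := norm_mul _ _
      _ ≤ (|C| * Real.exp (‖(z : ℂ)‖ ^ σ)) * (|D| * Real.exp (‖(z : ℂ)‖ ^ σ)) :=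
        mul_le_mul h1 h2 (norm_nonneg _) (by positivity)
      _ = |C| * |D| * Real.exp (2 * ‖(z : ℂ)‖ ^ σ) := by rw [two_mul, Real.exp_add]; ring
      _ ≤ |C| * |D| * Real.exp (2 * |R| ^ σ + ‖(z : ℂ)‖ ^ ρ') := by gcongr
      _ = |C| * |D| * Real.exp (2 * |R| ^ σ) * Real.exp (‖(z : ℂ)‖ ^ ρ') := by
        rw [Real.exp_add]; ring
  ind := fun θ h1 h2 => by
    refine (indicator_nonpos_iff _ _ _).2 fun ε hε => ?_
    have hf' := (indicator_nonpos_iff _ _ _).1 (hf.ind θ h1 h2) (ε / 2) (half_pos hε)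
    have hg' := (indicator_nonpos_iff _ _ _).1 (hg.ind θ h1 h2) (ε / 2) (half_pos hε)
    filter_upwards [hf', hg', eventually_gt_atTop r₀] with r hr1 hr2 h0
    have hm := ray_mem h1 h2 h0
    have e : ∀ u : sector α β r₀ → ℂ, extend u _ = u ⟨_, hm⟩ := fun u => extend_apply u ⟨_, hm⟩
    rw [e] at hr1 hr2 ⊢
    have he : Real.exp (ε * r ^ ρ) = Real.exp (ε / 2 * r ^ ρ) * Real.exp (ε / 2 * r ^ ρ) := by
      rw [← Real.exp_add]; ring_nf
    rw [he, Pi.mul_apply, norm_mul]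
    exact mul_le_mul hr1 hr2 (norm_nonneg _) (Real.exp_pos _).le

/-- The algebra of the functions holomorphic on `S(α, β, r₀)`, of order at most `ρ`, whose
indicator of order `ρ` is nonpositive on `(α, β)`. -/
def slowAlgebra (α β r₀ ρ : ℝ) (hρ : 0 < ρ) : Subalgebra ℂ (sector α β r₀ → ℂ) where
  carrier := {f | IsSlow ρ f}
  mul_mem' := IsSlow.mul hρ
  add_mem' := IsSlow.add hρ
  algebraMap_mem' := IsSlow.const hρ

end

end AngleEq

namespace AngleEq

open Filter

/-! Call a function slow if its indicator of order `ρ` is nonpositive. A translation `w ↦ w - q`,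
with `q` the coefficient of degree `m - 1` divided by `m`, turns the equation into `g ^ m + ∑ c j *
g ^ j = exp p` with slow `c j`, `j < m - 1`, and `g = f + q`. Put `E = exp (p / m)`. Where `exp
(-p)` decays, dividing by `E ^ m` shows that `(g / E) ^ m - 1` is at most a slow factor times `|E| ^
(-2)`. Two powers are gained because the coefficient of degree `m - 1` is gone. Hence `g / E` stays
near one root of unity `ω`, and `g - ω * E` is still exponentially small (`exists_root_rayLe`).

On the remaining rays `exp p` is slow, so `g` and `E`, and with them `g - ω * E`, are slow. The
uniqueness theorem `StripFinite.eqOn_zero` then applies: a function slow in the whole angle vanishes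
if its indicator is negative in a direction farther than `π / ρ` from one end of the angle. Such a
direction exists because the angle is wider than `π / ρ`. So `g = ω * E` and `∑ c j * g ^ j = 0`.
Dividing by powers of `E`, the top coefficient decays on that direction, hence vanishes by the same
theorem, and so on downwards (`eq_branch_and_coeff_eq_zero`).

Uniqueness rests on trigonometric convexity of the indicator (`StripFinite.norm_le_sinInterp`),
which spreads one negative value into the value `-∞` on an interval of length `π / ρ`, and on the
half-plane theorem that a bounded function with superexponential decay is zero. Everything is done
in the coordinate `ζ = log z`, where the angle becomes a half-strip and `|z| ^ ρ` becomes `exp (ρ *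
re ζ)`. -/

/-! ### Phragmén–Lindelöf in a half-strip. -/

theorem tendsto_exp_sub_exp_atBot {c μ k : ℝ} (B : ℝ) (hc : 0 < c) (hμ : c < μ) (hk : 0 < k) :
    Tendsto (fun x : ℝ => B * Real.exp (c * x) - k * Real.exp (μ * x)) atTop atBot := by
  have h1 : Tendsto (fun x : ℝ => Real.exp (c * x)) atTop atTop :=
    Real.tendsto_exp_atTop.comp (tendsto_id.const_mul_atTop hc)
  have h2 : Tendsto (fun x : ℝ => B + -(k * Real.exp ((μ - c) * x))) atTop atBot :=
    tendsto_atBot_add_const_left _ _ (tendsto_neg_atTop_atBot.comp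
      ((Real.tendsto_exp_atTop.comp (tendsto_id.const_mul_atTop (sub_pos.2 hμ))).const_mul_atTop hk))
  refine (h1.atTop_mul_atBot₀ h2).congr fun x => ?_
  have : Real.exp (μ * x) = Real.exp (c * x) * Real.exp ((μ - c) * x) := by
    rw [← Real.exp_add]; ring_nf
  rw [this]; ring

theorem norm_exp_ofReal_mul_exp (k μ t : ℝ) (ζ : ℂ) :
    ‖Complex.exp ((k : ℂ) * Complex.exp ((μ : ℂ) * (ζ - (t : ℂ) * Complex.I)))‖
      = Real.exp (k * (Real.exp (μ * ζ.re) * Real.cos (μ * (ζ.im - t)))) := by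
  rw [Complex.norm_exp, Complex.re_ofReal_mul, Complex.exp_re]
  simp

/-- Phragmén–Lindelöf principle in a closed half-strip `{re ζ ≥ x₁, a ≤ im ζ ≤ b}`. -/
theorem norm_le_of_halfStrip {F : ℂ → ℂ} {a b x₁ c B C M : ℝ} (hab : a < b) (hc : 0 < c)
    (hcab : c * (b - a) < Real.pi) (hM : 0 < M)
    (hd : ∀ ζ : ℂ, x₁ ≤ ζ.re → ζ.im ∈ Set.Icc a b → DifferentiableAt ℂ F ζ)
    (hg : ∀ ζ : ℂ, x₁ ≤ ζ.re → ζ.im ∈ Set.Icc a b → ‖F ζ‖ ≤ C * Real.exp (B * Real.exp (c * ζ.re)))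
    (hleft : ∀ y ∈ Set.Icc a b, ‖F ⟨x₁, y⟩‖ ≤ M)
    (hbot : ∀ x, x₁ ≤ x → ‖F ⟨x, a⟩‖ ≤ M) (htop : ∀ x, x₁ ≤ x → ‖F ⟨x, b⟩‖ ≤ M)
    {ζ : ℂ} (hre : x₁ ≤ ζ.re) (him : ζ.im ∈ Set.Icc a b) : ‖F ζ‖ ≤ M := by
  have hba : 0 < b - a := sub_pos.2 hab
  -- Since `μ > c`, the damping factor `exp (-ε e^{μ(ζ - it)})` beats the growth of `F`. Since `μ (b
  -- - a) < π`, the cosine in its modulus is at least `δ > 0` on the strip centred at `t`.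
  obtain ⟨μ, hcμ, hμ⟩ := exists_between ((lt_div_iff₀ hba).2 hcab)
  rw [lt_div_iff₀ hba] at hμ
  have hμ0 : 0 < μ := hc.trans hcμ
  set t := (a + b) / 2 with ht
  set δ := Real.cos (μ * ((b - a) / 2)) with hδ
  have hδ0 : 0 < δ := Real.cos_pos_of_mem_Ioo ⟨by nlinarith [Real.pi_pos], by nlinarith⟩
  have hcos : ∀ y ∈ Set.Icc a b, δ ≤ Real.cos (μ * (y - t)) := by
    intro y hy
    rw [← Real.cos_abs (μ * (y - t)), abs_mul, abs_of_pos hμ0]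
    refine Real.cos_le_cos_of_nonneg_of_le_pi (by positivity) (by nlinarith [Real.pi_pos]) ?_
    refine mul_le_mul_of_nonneg_left ?_ hμ0.le
    rw [abs_le]; constructor <;> linarith [hy.1, hy.2]
  set G : ℝ → ℂ → ℂ := fun ε z =>
    F z * Complex.exp (((-ε : ℝ) : ℂ) * Complex.exp ((μ : ℂ) * (z - (t : ℂ) * Complex.I))) with hG
  have hGn : ∀ ε z, ‖G ε z‖
      = ‖F z‖ * Real.exp (-ε * (Real.exp (μ * z.re) * Real.cos (μ * (z.im - t)))) := by
    intro ε z
    rw [hG, norm_mul, norm_exp_ofReal_mul_exp]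
  have hGle : ∀ ε > 0, ∀ z : ℂ, z.im ∈ Set.Icc a b →
      ‖G ε z‖ ≤ ‖F z‖ * Real.exp (-(ε * δ * Real.exp (μ * z.re))) := by
    intro ε hε z hz
    rw [hGn]
    gcongr
    have := mul_le_mul_of_nonneg_left (hcos _ hz) (mul_pos hε (Real.exp_pos (μ * z.re))).le
    nlinarith
  have hGF : ∀ ε > 0, ∀ z : ℂ, z.im ∈ Set.Icc a b → ‖G ε z‖ ≤ ‖F z‖ := by
    intro ε hε z hz
    refine (hGle ε hε z hz).trans (mul_le_of_le_one_right (norm_nonneg _) ?_)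
    rw [Real.exp_le_one_iff]
    have := mul_pos (mul_pos hε hδ0) (Real.exp_pos (μ * z.re))
    linarith
  have key : ∀ ε > 0, ‖G ε ζ‖ ≤ M := by
    intro ε hε
    have hlim : Tendsto (fun x : ℝ => C * Real.exp (B * Real.exp (c * x)
        - ε * δ * Real.exp (μ * x))) atTop (nhds (C * 0)) :=
      (Real.tendsto_exp_atBot.comp
        (tendsto_exp_sub_exp_atBot B hc hcμ (mul_pos hε hδ0))).const_mul C
    rw [mul_zero] at hlim
    -- Far enough to the right the damped function is below `M` on the vertical edge, so the maximum
    -- principle on a rectangle applies.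
    obtain ⟨X, hX, hXζ⟩ := ((hlim.eventually_le_const hM).and
      (eventually_gt_atTop ζ.re)).exists
    have hx : x₁ < X := hre.trans_lt hXζ
    have hcl : closure (Set.Ioo x₁ X ×ℂ Set.Ioo a b) = Set.Icc x₁ X ×ℂ Set.Icc a b := by
      rw [Complex.closure_reProdIm, closure_Ioo hx.ne, closure_Ioo hab.ne]
    refine Complex.norm_le_of_forall_mem_frontier_norm_le
      (U := Set.Ioo x₁ X ×ℂ Set.Ioo a b) (f := G ε)
      ((Metric.isBounded_Ioo _ _).reProdIm (Metric.isBounded_Ioo _ _)) ?_ ?_ ?_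
    · refine DifferentiableOn.diffContOnCl fun z hz => ?_
      rw [hcl, Complex.mem_reProdIm] at hz
      refine DifferentiableAt.differentiableWithinAt ((hd z hz.1.1 hz.2).mul ?_)
      fun_prop
    · intro z hz
      have hz' : z ∈ Set.Icc x₁ X ×ℂ Set.Icc a b := hcl ▸ frontier_subset_closure hz
      rw [Complex.mem_reProdIm] at hz'
      rw [Complex.frontier_reProdIm, closure_Ioo hx.ne, closure_Ioo hab.ne,
        frontier_Ioo hx, frontier_Ioo hab] at hz
      rcases hz with hz | hz <;> rw [Complex.mem_reProdIm] at hz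
      · refine (hGF ε hε z hz'.2).trans ?_
        rcases hz.2 with h | h
        · have := hbot z.re hz'.1.1
          rwa [← h] at this
        · have := htop z.re hz'.1.1
          rwa [← Set.mem_singleton_iff.1 h] at this
      · rcases hz.1 with h | h
        · refine (hGF ε hε z hz'.2).trans ?_
          have := hleft z.im hz'.2
          rwa [← h] at this
        · rw [Set.mem_singleton_iff] at h
          refine (hGle ε hε z hz'.2).trans (le_trans ?_ hX)
          refine (mul_le_mul_of_nonneg_right (hg z hz'.1.1 hz'.2) (Real.exp_pos _).le).trans ?_
          rw [mul_assoc, ← Real.exp_add, h, sub_eq_add_neg]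
    · rw [hcl, Complex.mem_reProdIm]
      exact ⟨⟨hre, hXζ.le⟩, him⟩
  have hcont : Tendsto (fun ε : ℝ => ‖G ε ζ‖) (nhdsWithin 0 (Set.Ioi 0)) (nhds ‖F ζ‖) := by
    have : Continuous fun ε : ℝ => ‖G ε ζ‖ := by
      simp only [hGn]; fun_prop
    have h0 := this.tendsto 0
    simp only [hGn, neg_zero, zero_mul, Real.exp_zero, mul_one] at h0 ⊢
    exact h0.mono_left nhdsWithin_le_nhds
  exact le_of_tendsto hcont (eventually_mem_nhdsWithin.mono fun ε hε => key ε hε)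

/-! ### Logarithmic coordinates and growth conditions. -/

/-- The logarithmic image of the angle. -/
def logSector (α β r₀ : ℝ) : Set ℂ := {ζ | r₀ < Real.exp ζ.re ∧ α < ζ.im ∧ ζ.im < β}

theorem logSector_eq (α β r₀ : ℝ) :
    logSector α β r₀ = {x | r₀ < Real.exp x} ×ℂ Set.Ioo α β := by
  ext ζ
  simp [logSector, Complex.mem_reProdIm]

theorem isOpen_logSector (α β r₀ : ℝ) : IsOpen (logSector α β r₀) := by
  rw [logSector_eq]
  exact (isOpen_lt continuous_const Real.continuous_exp).reProdIm isOpen_Ioo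

theorem convex_logSector (α β r₀ : ℝ) : Convex ℝ (logSector α β r₀) := by
  rw [logSector_eq]
  have h : Convex ℝ {x : ℝ | r₀ < Real.exp x} := Set.OrdConnected.convex
    ⟨fun x hx y _ z hz => lt_of_lt_of_le hx (Real.exp_le_exp.2 hz.1)⟩
  exact (h.linear_preimage Complex.reLm).inter ((convex_Ioo α β).linear_preimage Complex.imLm)

/-- Holomorphic on the logarithmic angle and, in the original variable, of order at most `ρ`. -/
structure StripFinite (α β r₀ ρ : ℝ) (F : ℂ → ℂ) : Prop where
  diff : DifferentiableOn ℂ F (logSector α β r₀)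
  order : ∀ ρ' : ℝ, ρ < ρ' → ∃ C : ℝ, ∀ ζ ∈ logSector α β r₀,
    ‖F ζ‖ ≤ C * Real.exp (Real.exp (ρ' * ζ.re))

/-- On the ray with argument `θ`, `F` is eventually at most `exp (c r ^ ρ)`, where `r = exp x`. -/
def RayLe (F : ℂ → ℂ) (ρ θ c : ℝ) : Prop :=
  ∀ᶠ x : ℝ in atTop, ‖F ⟨x, θ⟩‖ ≤ Real.exp (c * Real.exp (ρ * x))

theorem RayLe.mono {F : ℂ → ℂ} {ρ θ c d : ℝ} (h : RayLe F ρ θ c) (hcd : c ≤ d) : RayLe F ρ θ d := by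
  filter_upwards [h] with x hx
  exact hx.trans (Real.exp_le_exp.2 (mul_le_mul_of_nonneg_right hcd (Real.exp_pos _).le))

theorem StripFinite.mono {α β α' β' r₀ ρ : ℝ} {F : ℂ → ℂ} (h : StripFinite α β r₀ ρ F)
    (hα : α ≤ α') (hβ : β' ≤ β) : StripFinite α' β' r₀ ρ F := by
  have hs : logSector α' β' r₀ ⊆ logSector α β r₀ := fun ζ hζ =>
    ⟨hζ.1, hα.trans_lt hζ.2.1, hζ.2.2.trans_le hβ⟩
  refine ⟨h.diff.mono hs, fun ρ' hρ' => ?_⟩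
  obtain ⟨C, hC⟩ := h.order ρ' hρ'
  exact ⟨C, fun ζ hζ => hC ζ (hs hζ)⟩

/-! ### Sinusoidal majorants of the indicator. -/

/-- The sinusoid with values `A` at `a` and `B` at `b`. -/
noncomputable def sinInterp (ρ a b A B y : ℝ) : ℝ :=
  (A * Real.sin (ρ * (b - y)) + B * Real.sin (ρ * (y - a))) / Real.sin (ρ * (b - a))

theorem sinInterp_left {ρ a b : ℝ} (A B : ℝ) (h : Real.sin (ρ * (b - a)) ≠ 0) :
    sinInterp ρ a b A B a = A := by
  simp [sinInterp, h]

theorem sinInterp_right {ρ a b : ℝ} (A B : ℝ) (h : Real.sin (ρ * (b - a)) ≠ 0) :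
    sinInterp ρ a b A B b = B := by
  simp [sinInterp, h]

/-- Makes the majorant harmonic: multiplying `F` by `exp (-k e^{ρζ})` reduces the sinusoidal bound
to boundedness by a constant. -/
theorem exists_re_eq_sinInterp (ρ a b A B : ℝ) : ∃ k : ℂ, ∀ ζ : ℂ,
    (k * Complex.exp ((ρ : ℂ) * ζ)).re = sinInterp ρ a b A B ζ.im * Real.exp (ρ * ζ.re) := by
  refine ⟨⟨(A * Real.sin (ρ * b) - B * Real.sin (ρ * a)) / Real.sin (ρ * (b - a)),
    (A * Real.cos (ρ * b) - B * Real.cos (ρ * a)) / Real.sin (ρ * (b - a))⟩, fun ζ => ?_⟩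
  rw [Complex.mul_re, Complex.exp_re, Complex.exp_im, sinInterp, mul_sub ρ b ζ.im, mul_sub ρ ζ.im,
    Real.sin_sub (ρ * b) (ρ * ζ.im), Real.sin_sub (ρ * ζ.im)]
  simp only [Complex.re_ofReal_mul, Complex.im_ofReal_mul]
  ring

/-- The indicator lies below the sinusoid through two of its values, uniformly between them. -/
theorem StripFinite.norm_le_sinInterp {α β r₀ ρ a b A B : ℝ} {F : ℂ → ℂ} (hρ : 0 < ρ)
    (hF : StripFinite α β r₀ ρ F) (ha : α < a) (hab : a < b) (hb : b < β)
    (hd : ρ * (b - a) < Real.pi) (hA : RayLe F ρ a A) (hB : RayLe F ρ b B) :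
    ∃ M x₁ : ℝ, 0 < M ∧ r₀ < Real.exp x₁ ∧ ∀ x, x₁ ≤ x → ∀ y ∈ Set.Icc a b,
      ‖F ⟨x, y⟩‖ ≤ M * Real.exp (sinInterp ρ a b A B y * Real.exp (ρ * x)) := by
  have hba : 0 < b - a := sub_pos.2 hab
  have hs : Real.sin (ρ * (b - a)) ≠ 0 :=
    (Real.sin_pos_of_pos_of_lt_pi (mul_pos hρ hba) hd).ne'
  obtain ⟨k, hk⟩ := exists_re_eq_sinInterp ρ a b A B
  -- Finite order gives bounds only for exponents above `ρ`; the strict inequality `ρ (b - a) < π`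
  -- leaves room for such an exponent in Phragmén–Lindelöf.
  obtain ⟨c, hρc, hc⟩ := exists_between ((lt_div_iff₀ hba).2 hd)
  rw [lt_div_iff₀ hba] at hc
  obtain ⟨σ, hρσ, hσc⟩ := exists_between hρc
  obtain ⟨C, hC⟩ := hF.order σ hρσ
  -- The requirement `x₁ ≥ 0` lets `exp (c x)` dominate both `exp (σ x)` and `exp (ρ x)`.
  obtain ⟨x₁, hx₁⟩ := eventually_atTop.1 ((hA.and hB).and
    ((Real.tendsto_exp_atTop.eventually_gt_atTop r₀).and (eventually_ge_atTop (0 : ℝ))))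
  have hmem : ∀ ζ : ℂ, x₁ ≤ ζ.re → ζ.im ∈ Set.Icc a b → ζ ∈ logSector α β r₀ := fun ζ h1 h2 =>
    ⟨(hx₁ _ h1).2.1, ha.trans_le h2.1, h2.2.trans_lt hb⟩
  set G : ℂ → ℂ := fun ζ => F ζ * Complex.exp (-(k * Complex.exp ((ρ : ℂ) * ζ))) with hG
  have hGn : ∀ ζ, ‖G ζ‖ = ‖F ζ‖ * Real.exp (-(sinInterp ρ a b A B ζ.im * Real.exp (ρ * ζ.re))) := by
    intro ζ
    rw [hG, norm_mul, Complex.norm_exp, Complex.neg_re, hk]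
  have hGd : ∀ ζ : ℂ, x₁ ≤ ζ.re → ζ.im ∈ Set.Icc a b → DifferentiableAt ℂ G ζ := by
    intro ζ h1 h2
    refine (hF.diff.differentiableAt ((isOpen_logSector _ _ _).mem_nhds (hmem ζ h1 h2))).mul ?_
    fun_prop
  have hcomp : ContinuousOn (fun y : ℝ => ‖G ⟨x₁, y⟩‖) (Set.Icc a b) := by
    intro y hy
    have h1 : ContinuousAt G ⟨x₁, y⟩ := (hGd ⟨x₁, y⟩ le_rfl hy).continuousAt
    have h2 : Continuous fun y : ℝ => (⟨x₁, y⟩ : ℂ) := by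
      have : (fun y : ℝ => (⟨x₁, y⟩ : ℂ)) = fun y : ℝ => (x₁ : ℂ) + y * Complex.I := by
        ext y
        apply Complex.ext <;> simp
      rw [this]; fun_prop
    exact ((ContinuousAt.comp (f := fun y : ℝ => (⟨x₁, y⟩ : ℂ)) h1
      h2.continuousAt).norm).continuousWithinAt
  obtain ⟨M, hM⟩ := isCompact_Icc.bddAbove_image hcomp
  refine ⟨max M 1, x₁, by positivity, (hx₁ _ le_rfl).2.1, fun x hx y hy => ?_⟩
  have hfin : ‖G ⟨x, y⟩‖ ≤ max M 1 := by
    refine norm_le_of_halfStrip (F := G) (x₁ := x₁) (c := c) (B := 1 + ‖k‖) (C := |C|) hab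
      (hρ.trans hρc) hc (by positivity) hGd ?_ ?_ ?_ ?_ hx hy
    · intro ζ h1 h2
      have h0 : 0 ≤ ζ.re := (hx₁ _ h1).2.2
      rw [hG, norm_mul]
      have e1 : ‖F ζ‖ ≤ |C| * Real.exp (Real.exp (c * ζ.re)) := by
        refine (hC ζ (hmem ζ h1 h2)).trans ?_
        gcongr
        exact le_abs_self C
      have e2 : ‖Complex.exp (-(k * Complex.exp ((ρ : ℂ) * ζ)))‖
          ≤ Real.exp (‖k‖ * Real.exp (c * ζ.re)) := by
        rw [Complex.norm_exp]
        refine Real.exp_le_exp.2 ((Complex.re_le_norm _).trans ?_)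
        rw [norm_neg, norm_mul, Complex.norm_exp, Complex.re_ofReal_mul]
        gcongr
      calc _ ≤ |C| * Real.exp (Real.exp (c * ζ.re)) * Real.exp (‖k‖ * Real.exp (c * ζ.re)) := by
            gcongr
        _ = _ := by rw [mul_assoc, ← Real.exp_add]; ring_nf
    · intro y hy
      exact (hM (Set.mem_image_of_mem _ hy)).trans (le_max_left _ _)
    · intro x hx
      refine le_trans ?_ (le_max_right _ _)
      rw [hGn, sinInterp_left A B hs, Real.exp_neg, ← div_eq_mul_inv, div_le_one (Real.exp_pos _)]
      exact (hx₁ x hx).1.1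
    · intro x hx
      refine le_trans ?_ (le_max_right _ _)
      rw [hGn, sinInterp_right A B hs, Real.exp_neg, ← div_eq_mul_inv, div_le_one (Real.exp_pos _)]
      exact (hx₁ x hx).1.2
  rwa [hGn, Real.exp_neg, ← div_eq_mul_inv, div_le_iff₀ (Real.exp_pos _)] at hfin

/-! ### Propagation of decay and the uniqueness theorem. -/

/-- The indicator of order `ρ` of `F` in the direction `θ` is nonpositive. -/
def RaySlow (F : ℂ → ℂ) (ρ θ : ℝ) : Prop := ∀ ε : ℝ, 0 < ε → RayLe F ρ θ ε

theorem tendsto_exp_mul_atTop {ρ : ℝ} (hρ : 0 < ρ) :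
    Tendsto (fun x : ℝ => Real.exp (ρ * x)) atTop atTop :=
  Real.tendsto_exp_atTop.comp (tendsto_id.const_mul_atTop hρ)

theorem eventually_mul_exp_le {ρ c c' : ℝ} (hρ : 0 < ρ) (hc : c < c') (M : ℝ) :
    ∀ᶠ x : ℝ in atTop, M * Real.exp (c * Real.exp (ρ * x)) ≤ Real.exp (c' * Real.exp (ρ * x)) := by
  have h : Tendsto (fun x : ℝ => Real.exp ((c' - c) * Real.exp (ρ * x))) atTop atTop :=
    Real.tendsto_exp_atTop.comp ((tendsto_exp_mul_atTop hρ).const_mul_atTop (sub_pos.2 hc))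
  filter_upwards [h.eventually_ge_atTop M] with x hx
  calc M * Real.exp (c * Real.exp (ρ * x))
      ≤ Real.exp ((c' - c) * Real.exp (ρ * x)) * Real.exp (c * Real.exp (ρ * x)) := by gcongr
    _ = _ := by rw [← Real.exp_add]; ring_nf

theorem StripFinite.rayLe_of_sinInterp_lt {α β r₀ ρ a b A B y c : ℝ} {F : ℂ → ℂ} (hρ : 0 < ρ)
    (hF : StripFinite α β r₀ ρ F) (ha : α < a) (hab : a < b) (hb : b < β)
    (hd : ρ * (b - a) < Real.pi) (hA : RayLe F ρ a A) (hB : RayLe F ρ b B)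
    (hy : y ∈ Set.Icc a b) (hc : sinInterp ρ a b A B y < c) : RayLe F ρ y c := by
  obtain ⟨M, x₁, -, -, h⟩ := hF.norm_le_sinInterp hρ ha hab hb hd hA hB
  filter_upwards [eventually_mul_exp_le hρ hc M, eventually_ge_atTop x₁] with x h1 h2
  exact (h x h2 y hy).trans h1

/-- A negative indicator at `θ` forces the indicator to be `-∞` on `(θ, θ + π / ρ)`. -/
theorem StripFinite.rayLe_of_decay {α β r₀ ρ θ c y : ℝ} {F : ℂ → ℂ} (hρ : 0 < ρ)
    (hF : StripFinite α β r₀ ρ F) (hslow : ∀ θ, α < θ → θ < β → RaySlow F ρ θ)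
    (hα : α < θ) (hβ : θ + Real.pi / ρ < β) (hc : 0 < c) (hdec : RayLe F ρ θ (-c))
    (hy : y ∈ Set.Ioo θ (θ + Real.pi / ρ)) (K : ℝ) : RayLe F ρ y (-K) := by
  set s := ρ * (y - θ) with hs
  have hs0 : 0 < s := mul_pos hρ (sub_pos.2 hy.1)
  have hsπ : s < Real.pi := by
    have : y - θ < Real.pi / ρ := by linarith [hy.2]
    rw [lt_div_iff₀ hρ] at this
    linarith
  have hsin : 0 < Real.sin s := Real.sin_pos_of_pos_of_lt_pi hs0 hsπ
  -- The sinusoid through `-c` at `θ` and `c / 2` at `b = θ + (π - η) / ρ` has at `y` the value `(-c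
  -- sin (η + s) + (c / 2) sin s) / sin η`. As `η → 0+` the numerator tends to a negative number, so
  -- the value tends to `-∞`.
  have hnum : Tendsto (fun η : ℝ => -c * Real.sin (η + s) + c / 2 * Real.sin s)
      (nhdsWithin 0 (Set.Ioi 0)) (nhds (-(c / 2 * Real.sin s))) := by
    have : Continuous fun η : ℝ => -c * Real.sin (η + s) + c / 2 * Real.sin s := by fun_prop
    have h0 := this.tendsto 0
    rw [zero_add, show -c * Real.sin s + c / 2 * Real.sin s = -(c / 2 * Real.sin s) by ring] at h0
    exact h0.mono_left nhdsWithin_le_nhds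
  have hden : Tendsto (fun η : ℝ => (Real.sin η)⁻¹) (nhdsWithin 0 (Set.Ioi 0)) atTop := by
    refine tendsto_inv_nhdsGT_zero.comp (tendsto_nhdsWithin_iff.2 ⟨?_, ?_⟩)
    · have := Real.continuous_sin.tendsto 0
      rw [Real.sin_zero] at this
      exact this.mono_left nhdsWithin_le_nhds
    · filter_upwards [Ioo_mem_nhdsGT Real.pi_pos] with η hη
      exact Real.sin_pos_of_pos_of_lt_pi hη.1 hη.2
  have hlim := hnum.neg_mul_atTop (by have := mul_pos (half_pos hc) hsin; linarith) hden
  obtain ⟨η, hη1, hη2⟩ := ((hlim.eventually_lt_atBot (-K)).and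
    (Ioo_mem_nhdsGT (sub_pos.2 hsπ))).exists
  have hπ := Real.pi_pos
  set b := θ + (Real.pi - η) / ρ with hb
  have hbθ : ρ * (b - θ) = Real.pi - η := by rw [hb]; field_simp; ring
  have hby : ρ * (b - y) = Real.pi - (η + s) := by linarith
  have hyb : y < b := by
    have : 0 < ρ * (b - y) := by rw [hby]; linarith [hη2.2]
    exact sub_pos.1 ((mul_pos_iff_of_pos_left hρ).1 this)
  have hbβ : b < β := by
    refine lt_trans ?_ hβ
    rw [hb]; gcongr; linarith [hη2.1]
  refine hF.rayLe_of_sinInterp_lt hρ hα (hy.1.trans hyb) hbβ (by linarith [hη2.1])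
    hdec (hslow b (hα.trans (hy.1.trans hyb)) hbβ (c / 2) (half_pos hc)) ⟨hy.1.le, hyb.le⟩ ?_
  rw [sinInterp, hby, hbθ, Real.sin_pi_sub, Real.sin_pi_sub, div_eq_mul_inv]
  exact hη1

/-- The value at `a` enters the sinusoid at `y` with positive weight `sin (ρ (b - y)) / sin (ρ (b -
a))`, so letting it tend to `-∞` with the value at `b` fixed gives `-∞` at `y`. -/
theorem StripFinite.rayLe_of_superdecay {α β r₀ ρ a b y : ℝ} {F : ℂ → ℂ} (hρ : 0 < ρ)
    (hF : StripFinite α β r₀ ρ F) (ha : α < a) (hb : b < β)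
    (hd : ρ * (b - a) < Real.pi) (hA : ∀ K, RayLe F ρ a (-K)) (hB : RayLe F ρ b 1)
    (hy : y ∈ Set.Ioo a b) (K : ℝ) : RayLe F ρ y (-K) := by
  have hby : 0 < Real.sin (ρ * (b - y)) := by
    refine Real.sin_pos_of_pos_of_lt_pi (mul_pos hρ (sub_pos.2 hy.2)) (lt_of_le_of_lt ?_ hd)
    exact mul_le_mul_of_nonneg_left (by linarith [hy.1]) hρ.le
  have hba : 0 < Real.sin (ρ * (b - a)) :=
    Real.sin_pos_of_pos_of_lt_pi (mul_pos hρ (by linarith [hy.1, hy.2])) hd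
  refine hF.rayLe_of_sinInterp_lt hρ ha (hy.1.trans hy.2) hb hd
    (hA ((1 + K * Real.sin (ρ * (b - a)) + Real.sin (ρ * (y - a))) / Real.sin (ρ * (b - y))))
    hB ⟨hy.1.le, hy.2.le⟩ ?_
  rw [sinInterp, div_lt_iff₀ hba, neg_mul, div_mul_cancel₀ _ hby.ne']
  linarith

theorem StripFinite.bounded_of_rayLe_zero {α β r₀ ρ a b : ℝ} {F : ℂ → ℂ} (hρ : 0 < ρ)
    (hF : StripFinite α β r₀ ρ F) (ha : α < a) (hab : a < b) (hb : b < β)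
    (hd : ρ * (b - a) < Real.pi) (hA : RayLe F ρ a 0) (hB : RayLe F ρ b 0) :
    ∃ M x₁ : ℝ, r₀ < Real.exp x₁ ∧ ∀ x, x₁ ≤ x → ∀ y ∈ Set.Icc a b, ‖F ⟨x, y⟩‖ ≤ M := by
  obtain ⟨M, x₁, -, h0, h⟩ := hF.norm_le_sinInterp hρ ha hab hb hd hA hB
  refine ⟨M, x₁, h0, fun x hx y hy => ?_⟩
  simpa [sinInterp] using h x hx y hy

theorem eqOn_zero_of_eventuallyEq {α β r₀ : ℝ} {F : ℂ → ℂ}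
    (hF : DifferentiableOn ℂ F (logSector α β r₀)) {ζ : ℂ} (hζ : ζ ∈ logSector α β r₀)
    (h : F =ᶠ[nhds ζ] 0) : Set.EqOn F 0 (logSector α β r₀) :=
  (hF.analyticOnNhd (isOpen_logSector α β r₀)).eqOn_zero_of_preconnected_of_eventuallyEq_zero
    (convex_logSector α β r₀).isPreconnected hζ h

/-- A function with indicator `-∞` on a closed interval of length `π / ρ` vanishes. -/
theorem StripFinite.eqOn_zero_of_superdecay {α β r₀ ρ a b : ℝ} {F : ℂ → ℂ} (hρ : 0 < ρ)
    (hF : StripFinite α β r₀ ρ F) (ha : α < a) (hb : b < β) (hab : ρ * (b - a) = Real.pi)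
    (hdec : ∀ y ∈ Set.Icc a b, ∀ K, RayLe F ρ y (-K)) :
    Set.EqOn F 0 (logSector α β r₀) := by
  have hπ := Real.pi_pos
  have hba : a < b := by
    have : 0 < ρ * (b - a) := by linarith
    exact sub_pos.1 ((mul_pos_iff_of_pos_left hρ).1 this)
  set t := (a + b) / 2 with ht
  have hat : a < t := by rw [ht]; linarith
  have htb : t < b := by rw [ht]; linarith
  have hdec0 : ∀ y ∈ Set.Icc a b, RayLe F ρ y 0 := fun y hy => by simpa using hdec y hy 0
  -- The sinusoidal bound needs an interval shorter than `π / ρ`, so boundedness is obtained on the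
  -- two halves.
  obtain ⟨M₁, x₁, hx₁, hM₁⟩ := hF.bounded_of_rayLe_zero hρ ha hat (htb.trans hb)
    (by rw [ht]; nlinarith) (hdec0 a ⟨le_rfl, hba.le⟩) (hdec0 t ⟨hat.le, htb.le⟩)
  obtain ⟨M₂, x₂, hx₂, hM₂⟩ := hF.bounded_of_rayLe_zero hρ (ha.trans hat) htb hb
    (by rw [ht]; nlinarith) (hdec0 t ⟨hat.le, htb.le⟩) (hdec0 b ⟨hba.le, le_rfl⟩)
  set X := max x₁ x₂ with hX
  have hbd : ∀ ζ : ℂ, X ≤ ζ.re → ζ.im ∈ Set.Icc a b → ‖F ζ‖ ≤ max M₁ M₂ := by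
    intro ζ h1 h2
    rcases le_total ζ.im t with h | h
    · exact (hM₁ ζ.re ((le_max_left _ _).trans h1) ζ.im ⟨h2.1, h⟩).trans (le_max_left _ _)
    · exact (hM₂ ζ.re ((le_max_right _ _).trans h1) ζ.im ⟨h, h2.2⟩).trans (le_max_right _ _)
  have hmem : ∀ ζ : ℂ, X ≤ ζ.re → ζ.im ∈ Set.Icc a b → ζ ∈ logSector α β r₀ := fun ζ h1 h2 =>
    ⟨hx₁.trans_le (Real.exp_le_exp.2 ((le_max_left _ _).trans h1)), ha.trans_le h2.1,
      h2.2.trans_lt hb⟩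
  set R := Real.exp (ρ * X) with hR
  have hR0 : 0 < R := Real.exp_pos _
  -- This maps the closed right half-plane into the half-strip; the shift by `R` keeps real parts at
  -- least `X`. As `exp (ρ * re (φ w)) = |w + R|`, decay at every rate on the middle ray becomes
  -- superexponential decay on the positive axis.
  set φ : ℂ → ℂ := fun w => Complex.log (w + R) / ρ + t * Complex.I with hφ
  have hslit : ∀ w : ℂ, 0 ≤ w.re → 0 < (w + R).re := fun w hw => by
    rw [Complex.add_re, Complex.ofReal_re]; linarith
  have hφre : ∀ w, (φ w).re = Real.log ‖w + R‖ / ρ := fun w => by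
    simp [hφ, Complex.div_ofReal_re, Complex.log_re]
  have hφim : ∀ w, (φ w).im = (w + R).arg / ρ + t := fun w => by
    simp [hφ, Complex.div_ofReal_im, Complex.log_im]
  have hφ1 : ∀ w : ℂ, 0 ≤ w.re → X ≤ (φ w).re := fun w hw => by
    have h1 : R ≤ ‖w + R‖ := by
      refine le_trans ?_ (Complex.re_le_norm _)
      rw [Complex.add_re, Complex.ofReal_re]; linarith
    rw [hφre, le_div_iff₀ hρ, Real.le_log_iff_exp_le (hR0.trans_le h1), mul_comm]
    exact h1
  have hφ2 : ∀ w : ℂ, 0 ≤ w.re → (φ w).im ∈ Set.Icc a b := fun w hw => by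
    have h1 := abs_le.1 (Complex.abs_arg_le_pi_div_two_iff.2 (hslit w hw).le)
    rw [hφim, Set.mem_Icc, ← sub_le_iff_le_add, ← le_sub_iff_add_le, le_div_iff₀ hρ,
      div_le_iff₀ hρ, ht]
    constructor <;> nlinarith
  have hzero := PhragmenLindelof.eq_zero_on_right_half_plane_of_superexponential_decay
    (f := fun w => F (φ w)) ?_ ⟨0, by norm_num, 0, ?_⟩ ?_ ⟨max M₁ M₂, fun x => ?_⟩
  · have hζ0 : (⟨X + 1, t⟩ : ℂ) ∈ logSector α β r₀ := hmem _ (by simp) ⟨hat.le, htb.le⟩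
    refine eqOn_zero_of_eventuallyEq hF.diff hζ0 ?_
    have hcont : Continuous fun ζ : ℂ => (Complex.exp (ρ * (ζ - t * Complex.I)) - R).re := by
      fun_prop
    have him : Continuous fun ζ : ℂ => ρ * (ζ.im - t) := by fun_prop
    have e1 : ∀ᶠ ζ in nhds (⟨X + 1, t⟩ : ℂ),
        0 < (Complex.exp (ρ * (ζ - t * Complex.I)) - R).re := by
      refine hcont.tendsto _ |>.eventually_const_lt ?_
      rw [Complex.sub_re, Complex.exp_re, Complex.re_ofReal_mul, Complex.im_ofReal_mul]
      simp only [Complex.sub_re, Complex.sub_im, Complex.re_ofReal_mul, Complex.im_ofReal_mul,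
        Complex.I_re, Complex.I_im, Complex.ofReal_re]
      simp only [mul_zero, mul_one, sub_zero, sub_self, Real.cos_zero]
      rw [sub_pos, hR, Real.exp_lt_exp]
      nlinarith
    have e2 : ∀ᶠ ζ in nhds (⟨X + 1, t⟩ : ℂ), ρ * (ζ.im - t) ∈ Set.Ioo (-Real.pi) Real.pi := by
      refine (him.tendsto _).eventually (Ioo_mem_nhds ?_ ?_) <;> simp [hπ]
    filter_upwards [e1, e2] with ζ h1 h2
    have h3 : F (φ _) = 0 := hzero (x := Complex.exp (ρ * (ζ - t * Complex.I)) - R) h1.le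
    have h4 : φ (Complex.exp (ρ * (ζ - t * Complex.I)) - R) = ζ := by
      simp only [hφ, sub_add_cancel]
      rw [Complex.log_exp]
      · have : (ρ : ℂ) ≠ 0 := by exact_mod_cast hρ.ne'
        field_simp
        ring
      · rw [Complex.im_ofReal_mul]; simpa using h2.1
      · rw [Complex.im_ofReal_mul]; simpa using h2.2.le
    rwa [h4] at h3
  · refine DifferentiableOn.diffContOnCl fun w hw => ?_
    rw [Complex.closure_setOfPred_lt_re] at hw
    refine DifferentiableAt.differentiableWithinAt ?_
    have h1 : DifferentiableAt ℂ φ w := by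
      have : w + R ∈ Complex.slitPlane := Or.inl (hslit w hw)
      have h2 : DifferentiableAt ℂ (fun w : ℂ => Complex.log (w + R)) w :=
        DifferentiableAt.clog (by fun_prop) this
      exact (h2.div_const _).add_const _
    exact DifferentiableAt.comp w (hF.diff.differentiableAt
      ((isOpen_logSector _ _ _).mem_nhds (hmem _ (hφ1 w hw) (hφ2 w hw)))) h1
  · refine Asymptotics.IsBigO.of_bound (max M₁ M₂) ?_
    rw [eventually_inf_principal]
    refine Eventually.of_forall fun w hw => ?_
    have hw' : 0 ≤ w.re := le_of_lt hw
    simpa using hbd _ (hφ1 w hw') (hφ2 w hw')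
  · intro n
    have hlog : Tendsto (fun x : ℝ => Real.log (x + R) / ρ) atTop atTop :=
      (Real.tendsto_log_atTop.comp (tendsto_atTop_add_const_right _ _ tendsto_id)).atTop_div_const hρ
    -- The rate `n + 1` absorbs the factor `exp (n x)` and leaves `exp (-x)`.
    have hev := hlog.eventually (hdec t ⟨hat.le, htb.le⟩ (n + 1))
    refine squeeze_zero' (Eventually.of_forall fun x => by positivity) ?_
      Real.tendsto_exp_neg_atTop_nhds_zero
    filter_upwards [hev, eventually_ge_atTop 0] with x hx hx0
    have h1 : φ x = ⟨Real.log (x + R) / ρ, t⟩ := by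
      have h0 : 0 ≤ x + R := by positivity
      apply Complex.ext
      · rw [hφre, ← Complex.ofReal_add, Complex.norm_of_nonneg h0]
      · rw [hφim, ← Complex.ofReal_add, Complex.arg_ofReal_of_nonneg h0]; simp
    rw [mul_div_cancel₀ _ hρ.ne', Real.exp_log (by positivity), ← h1] at hx
    calc Real.exp x ^ n * ‖F (φ x)‖
        ≤ Real.exp (n * x) * Real.exp (-(n + 1) * (x + R)) := by
          rw [← Real.exp_nat_mul]; gcongr
      _ ≤ Real.exp (-x) := by
          rw [← Real.exp_add, Real.exp_le_exp]
          have : (0 : ℝ) ≤ n := Nat.cast_nonneg n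
          nlinarith
  · have h0 : 0 ≤ ((x : ℂ) * Complex.I).re := by simp
    exact hbd _ (hφ1 _ h0) (hφ2 _ h0)

/-- One negative value gives `-∞` only on an open interval of length `π / ρ`. The room left before
`β` carries the decay past its right end, so that a closed interval of that length fits. -/
theorem StripFinite.eqOn_zero_right {α β r₀ ρ θ c : ℝ} {F : ℂ → ℂ} (hρ : 0 < ρ)
    (hF : StripFinite α β r₀ ρ F) (hslow : ∀ θ, α < θ → θ < β → RaySlow F ρ θ)
    (hα : α < θ) (hβ : θ + Real.pi / ρ < β) (hc : 0 < c) (hdec : RayLe F ρ θ (-c)) :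
    Set.EqOn F 0 (logSector α β r₀) := by
  have hπ : 0 < Real.pi / ρ := div_pos Real.pi_pos hρ
  obtain ⟨δ, hδ0, hδ⟩ := exists_between
    (lt_min (half_pos (sub_pos.2 hβ)) (div_pos hπ (by norm_num : (0 : ℝ) < 3)))
  have hδ1 : θ + Real.pi / ρ + 2 * δ < β := by linarith [hδ.trans_le (min_le_left _ _)]
  have hδ2 : 3 * δ < Real.pi / ρ := by linarith [hδ.trans_le (min_le_right _ _)]
  have hs := fun y hy => hF.rayLe_of_decay (y := y) hρ hslow hα hβ hc hdec hy
  have hρπ : ρ * (Real.pi / ρ) = Real.pi := by field_simp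
  refine hF.eqOn_zero_of_superdecay (a := θ + δ) (b := θ + δ + Real.pi / ρ) hρ
    (by linarith) (by linarith) (by rw [add_sub_cancel_left, hρπ]) fun y hy => ?_
  rcases lt_or_ge y (θ + Real.pi / ρ) with h | h
  · exact hs y ⟨by linarith [hy.1], h⟩
  -- The auxiliary interval has length `π / ρ - δ`, below the critical one, and contains the part of
  -- `[θ + δ, θ + δ + π / ρ]` not yet covered.
  · refine hF.rayLe_of_superdecay (a := θ + 3 * δ) (b := θ + Real.pi / ρ + 2 * δ) hρ
      (by linarith) hδ1 (by nlinarith) (hs _ ⟨by linarith, by linarith⟩)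
      (hslow _ (by linarith) hδ1 1 one_pos) ⟨by linarith, by linarith [hy.2]⟩

/-- Conjugation exchanges the two ends of the angle, so uniqueness need be proved only for room on
the right. -/
theorem StripFinite.reflect {α β r₀ ρ : ℝ} {F : ℂ → ℂ} (hF : StripFinite α β r₀ ρ F) :
    StripFinite (-β) (-α) r₀ ρ
      (fun ζ => (starRingEnd ℂ) (F ((starRingEnd ℂ) ζ))) := by
  have hm : ∀ ζ ∈ logSector (-β) (-α) r₀, (starRingEnd ℂ) ζ ∈ logSector α β r₀ := fun ζ hζ => by
    obtain ⟨h1, h2, h3⟩ := hζ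
    refine ⟨by simpa using h1, ?_, ?_⟩ <;> rw [Complex.conj_im] <;> linarith
  refine ⟨fun ζ hζ => ?_, fun ρ' hρ' => ?_⟩
  · have := (hF.diff.differentiableAt ((isOpen_logSector _ _ _).mem_nhds (hm ζ hζ))).conj_conj
    rw [Complex.conj_conj] at this
    exact this.differentiableWithinAt
  · obtain ⟨C, hC⟩ := hF.order ρ' hρ'
    exact ⟨C, fun ζ hζ => by simpa using hC _ (hm ζ hζ)⟩

theorem rayLe_reflect {F : ℂ → ℂ} {ρ θ c : ℝ} (h : RayLe F ρ (-θ) c) :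
    RayLe (fun ζ => (starRingEnd ℂ) (F ((starRingEnd ℂ) ζ))) ρ θ c := by
  filter_upwards [h] with x hx
  rw [RCLike.norm_conj]
  exact hx

/-- Uniqueness: if the indicator is nonpositive, and negative at a point whose distance from one
end of the angle exceeds `π / ρ`, then the function vanishes. -/
theorem StripFinite.eqOn_zero {α β r₀ ρ θ c : ℝ} {F : ℂ → ℂ} (hρ : 0 < ρ)
    (hF : StripFinite α β r₀ ρ F) (hslow : ∀ θ, α < θ → θ < β → RaySlow F ρ θ)
    (hα : α < θ) (hβ : θ < β) (hθ : θ + Real.pi / ρ < β ∨ α < θ - Real.pi / ρ)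
    (hc : 0 < c) (hdec : RayLe F ρ θ (-c)) :
    Set.EqOn F 0 (logSector α β r₀) := by
  rcases hθ with h | h
  · exact hF.eqOn_zero_right hρ hslow hα h hc hdec
  · have := hF.reflect.eqOn_zero_right (θ := -θ) hρ
      (fun t h1 h2 ε hε => rayLe_reflect (hslow (-t) (by linarith) (by linarith) ε hε))
      (by linarith) (by linarith) hc (rayLe_reflect (by rwa [neg_neg]))
    intro ζ hζ
    have h1 := this (x := (starRingEnd ℂ) ζ) ⟨by simpa using hζ.1, by simpa using hζ.2.2,
      by simpa using hζ.2.1⟩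
    simpa using h1

/-! ### Selecting a branch of the `m`-th root. -/

/-- The sum stops below `m - 1`, so each `b j * φ ^ j / E ^ m` carries at least two factors `E⁻¹`
beside a power of `φ / E`. -/
theorem norm_div_pow_sub_one_le {m : ℕ} {φ E : ℂ} {b : ℕ → ℂ} (hm : 1 ≤ m) (hE : E ≠ 0)
    (h : φ ^ m + ∑ j ∈ Finset.range (m - 1), b j * φ ^ j = E ^ m) (he : ‖E⁻¹‖ ≤ 1)
    (hs : (∑ j ∈ Finset.range (m - 1), ‖b j‖) * ‖E⁻¹‖ ^ 2 ≤ 1) :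
    ‖(φ / E) ^ m - 1‖ ≤ 2 ^ m * ((∑ j ∈ Finset.range (m - 1), ‖b j‖) * ‖E⁻¹‖ ^ 2) := by
  set τ := (∑ j ∈ Finset.range (m - 1), ‖b j‖) * ‖E⁻¹‖ ^ 2 with hτ
  have hτ0 : 0 ≤ τ := by positivity
  set N := max 1 ‖φ / E‖ with hN
  have hN1 : 1 ≤ N := le_max_left _ _
  have e1 : (φ / E) ^ m - 1 = -∑ j ∈ Finset.range (m - 1), b j * (φ / E) ^ j * E⁻¹ ^ (m - j) := by
    have h1 : (φ / E) ^ m - 1 = -((∑ j ∈ Finset.range (m - 1), b j * φ ^ j) * E⁻¹ ^ m) := by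
      rw [eq_sub_of_add_eq' h, div_pow, inv_pow]
      field_simp
      ring
    rw [h1, Finset.sum_mul]
    congr 1
    refine Finset.sum_congr rfl fun j hj => ?_
    have hj' : j ≤ m := by have := Finset.mem_range.1 hj; omega
    rw [← Nat.add_sub_cancel' hj', pow_add, Nat.add_sub_cancel', div_eq_mul_inv, mul_pow]
    · ring
    · omega
  have e2 : ‖(φ / E) ^ m - 1‖ ≤ N ^ (m - 1) * τ := by
    rw [e1, norm_neg, hτ, mul_left_comm, mul_comm (N ^ _), ← mul_assoc, Finset.sum_mul,
      Finset.sum_mul]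
    refine (norm_sum_le _ _).trans (Finset.sum_le_sum fun j hj => ?_)
    have hj' := Finset.mem_range.1 hj
    rw [norm_mul, norm_mul, norm_pow, norm_pow, mul_right_comm]
    gcongr ?_ * ?_
    · exact mul_le_mul_of_nonneg_left
        (pow_le_pow_of_le_one (norm_nonneg _) he (by omega)) (norm_nonneg _)
    · exact (pow_le_pow_left₀ (norm_nonneg _) (le_max_right _ _) j).trans
        (pow_le_pow_right₀ hN1 hj'.le)
  -- If `N > 1`, the previous estimate with `τ ≤ 1` gives `N ^ m ≤ 1 + N ^ (m - 1) ≤ 2 N ^ (m - 1)`.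
  have hN2 : N ≤ 2 := by
    rcases le_total ‖φ / E‖ 1 with h1 | h1
    · rw [hN, max_eq_left h1]; norm_num
    · have h2 : N = ‖φ / E‖ := max_eq_right h1
      have h3 : N ^ m ≤ 1 + N ^ (m - 1) * τ := by
        rw [h2, ← norm_pow, ← h2]
        calc ‖(φ / E) ^ m‖ = ‖1 + ((φ / E) ^ m - 1)‖ := by congr 1; ring
          _ ≤ ‖(1 : ℂ)‖ + ‖(φ / E) ^ m - 1‖ := norm_add_le _ _
          _ ≤ _ := by rw [norm_one]; gcongr
      have h4 : (1 : ℝ) ≤ N ^ (m - 1) := one_le_pow₀ hN1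
      have h5 : N ^ m = N ^ (m - 1) * N := by rw [← pow_succ, Nat.sub_add_cancel hm]
      rw [h5] at h3
      have h6 : N ^ (m - 1) * N ≤ N ^ (m - 1) * 2 := by nlinarith
      exact le_of_mul_le_mul_left h6 (by positivity)
  refine e2.trans (mul_le_mul_of_nonneg_right ?_ hτ0)
  exact (pow_le_pow_left₀ (by positivity) hN2 _).trans
    (pow_le_pow_right₀ (by norm_num) (Nat.sub_le _ _))

theorem norm_exp_log_div_sub_one_le {m : ℕ} {z : ℂ} (hm : 1 ≤ m) (hz : ‖z - 1‖ ≤ 1 / 2) :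
    ‖Complex.exp (Complex.log z / m) - 1‖ ≤ 3 * ‖z - 1‖ := by
  have h1 : ‖Complex.log z / m‖ ≤ 3 / 2 * ‖z - 1‖ := by
    have h2 := Complex.norm_log_one_add_half_le_self hz
    rw [add_sub_cancel] at h2
    rw [norm_div, Complex.norm_natCast]
    exact (div_le_self (norm_nonneg _) (by exact_mod_cast hm)).trans h2
  refine (Complex.norm_exp_sub_one_le (by linarith)).trans ?_
  linarith

/-- A continuous function on a connected set whose `m`-th power is near `1` stays near a single
`m`-th root of unity. -/
theorem exists_root_of_unity_near {m : ℕ} (hm : 1 ≤ m) {D : Set ℂ} (hD : IsPreconnected D)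
    {L : ℂ → ℂ} (hL : ContinuousOn L D) (h : ∀ ζ ∈ D, ‖L ζ ^ m - 1‖ ≤ 1 / 2) :
    ∃ ω : ℂ, ω ^ m = 1 ∧ ∀ ζ ∈ D, ‖L ζ - ω‖ ≤ 3 * ‖L ζ ^ m - 1‖ := by
  have hm0 : m ≠ 0 := by omega
  have hmC : (m : ℂ) ≠ 0 := by exact_mod_cast hm0
  rcases D.eq_empty_or_nonempty with rfl | ⟨ζ₀, hζ₀⟩
  · exact ⟨1, one_pow _, fun ζ hζ => hζ.elim⟩
  have hsl : ∀ ζ ∈ D, L ζ ^ m ∈ Complex.slitPlane := fun ζ hζ => by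
    refine Complex.ball_one_subset_slitPlane ?_
    rw [Metric.mem_ball, dist_eq_norm]
    linarith [h ζ hζ]
  set R : ℂ → ℂ := fun ζ => Complex.exp (Complex.log (L ζ ^ m) / m) with hR
  have hRm : ∀ ζ ∈ D, R ζ ^ m = L ζ ^ m := fun ζ hζ => by
    rw [hR, ← Complex.exp_nat_mul, mul_div_cancel₀ _ hmC,
      Complex.exp_log (Complex.slitPlane_ne_zero (hsl ζ hζ))]
  have hRc : ContinuousOn R D := by
    refine Complex.continuous_exp.comp_continuousOn (ContinuousOn.div_const ?_ _)
    exact ContinuousOn.clog (hL.pow m) hsl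
  have hR0 : ∀ ζ, R ζ ≠ 0 := fun ζ => Complex.exp_ne_zero _
  have hQ1 : ∀ ζ ∈ D, (L ζ / R ζ) ^ m = 1 := fun ζ hζ => by
    rw [div_pow, hRm ζ hζ, div_self (Complex.slitPlane_ne_zero (hsl ζ hζ))]
  have hQc : ContinuousOn (fun ζ => L ζ / R ζ) D := hL.div hRc fun ζ _ => hR0 ζ
  have hfin : {z : ℂ | z ^ m = 1}.Finite := by
    refine (Polynomial.nthRoots m (1 : ℂ)).toFinset.finite_toSet.subset fun z hz => ?_
    simpa [Polynomial.mem_nthRoots (Nat.pos_of_ne_zero hm0)] using hz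
  -- The continuous quotient of `L` by the principal root of `L ^ m` takes values in a finite set,
  -- hence is constant on the connected set.
  have hsub := hfin.countable.isTotallyDisconnected _
    (Set.image_subset_iff.2 hQ1) (hD.image _ hQc)
  refine ⟨L ζ₀ / R ζ₀, hQ1 _ hζ₀, fun ζ hζ => ?_⟩
  have hω : L ζ = L ζ₀ / R ζ₀ * R ζ := by
    rw [← hsub (Set.mem_image_of_mem _ hζ) (Set.mem_image_of_mem _ hζ₀), div_mul_cancel₀ _ (hR0 ζ)]
  have hn : ‖L ζ₀ / R ζ₀‖ = 1 := by
    have := congrArg norm (hQ1 _ hζ₀)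
    rw [norm_pow, norm_one] at this
    exact (pow_eq_one_iff_of_nonneg (norm_nonneg _) hm0).1 this
  calc ‖L ζ - L ζ₀ / R ζ₀‖ = ‖L ζ₀ / R ζ₀ * (R ζ - 1)‖ := by rw [hω]; congr 1; ring
    _ = ‖R ζ - 1‖ := by rw [norm_mul, hn, one_mul]
    _ ≤ _ := norm_exp_log_div_sub_one_le hm (h ζ hζ)

theorem StripFinite.eventually_norm_le_of_slow {α β r₀ ρ a b ε : ℝ} {F : ℂ → ℂ} (hρ : 0 < ρ)
    (hF : StripFinite α β r₀ ρ F) (ha : α < a) (hab : a < b) (hb : b < β)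
    (hd : ρ * (b - a) < Real.pi) (hA : RaySlow F ρ a) (hB : RaySlow F ρ b) (hε : 0 < ε) :
    ∀ᶠ x : ℝ in atTop, ∀ y ∈ Set.Icc a b, ‖F ⟨x, y⟩‖ ≤ Real.exp (ε * Real.exp (ρ * x)) := by
  have hs : 0 < Real.sin (ρ * (b - a)) :=
    Real.sin_pos_of_pos_of_lt_pi (mul_pos hρ (sub_pos.2 hab)) hd
  -- The sinusoid with both end values `η` is at most `2 η / sin (ρ (b - a)) = ε / 2`; the other
  -- half of `ε` absorbs `M`.
  set η := ε / 4 * Real.sin (ρ * (b - a)) with hη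
  have hη0 : 0 < η := by positivity
  obtain ⟨M, x₁, hM, -, h⟩ := hF.norm_le_sinInterp hρ ha hab hb hd (hA η hη0) (hB η hη0)
  filter_upwards [eventually_mul_exp_le hρ (half_lt_self hε) M, eventually_ge_atTop x₁]
    with x h1 h2 y hy
  refine (h x h2 y hy).trans (le_trans ?_ h1)
  have : sinInterp ρ a b η η y ≤ ε / 2 := by
    rw [sinInterp, div_le_iff₀ hs]
    have h3 := Real.sin_le_one (ρ * (b - y))
    have h4 := Real.sin_le_one (ρ * (y - a))
    nlinarith
  gcongr

theorem StripFinite.eventually_norm_le_of_decay {α β r₀ ρ a b d : ℝ} {F : ℂ → ℂ} (hρ : 0 < ρ)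
    (hF : StripFinite α β r₀ ρ F) (ha : α < a) (hab : a < b) (hb : b < β)
    (hd : ρ * (b - a) < Real.pi) (hd0 : 0 < d) (hA : RayLe F ρ a (-d)) (hB : RayLe F ρ b (-d)) :
    ∀ᶠ x : ℝ in atTop, ∀ y ∈ Set.Icc a b,
      ‖F ⟨x, y⟩‖ ≤ Real.exp (-(d / 2) * Real.exp (ρ * x)) := by
  have hs : 0 < Real.sin (ρ * (b - a)) :=
    Real.sin_pos_of_pos_of_lt_pi (mul_pos hρ (sub_pos.2 hab)) hd
  obtain ⟨M, x₁, hM, -, h⟩ := hF.norm_le_sinInterp hρ ha hab hb hd hA hB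
  filter_upwards [eventually_mul_exp_le hρ (neg_lt_neg (half_lt_self hd0)) M,
    eventually_ge_atTop x₁] with x h1 h2 y hy
  refine (h x h2 y hy).trans (le_trans ?_ h1)
  -- This is `sin (u + v) ≤ sin u + sin v` for `u`, `v` in `[0, π]`.
  have : sinInterp ρ a b (-d) (-d) y ≤ -d := by
    have e : ρ * (b - a) = ρ * (b - y) + ρ * (y - a) := by ring
    have h3 : 0 ≤ Real.sin (ρ * (b - y)) := Real.sin_nonneg_of_nonneg_of_le_pi
      (mul_nonneg hρ.le (by linarith [hy.2])) (by nlinarith [hy.1])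
    have h4 : 0 ≤ Real.sin (ρ * (y - a)) := Real.sin_nonneg_of_nonneg_of_le_pi
      (mul_nonneg hρ.le (by linarith [hy.1])) (by nlinarith [hy.2])
    rw [sinInterp, div_le_iff₀ hs, e, Real.sin_add]
    have h5 := mul_le_of_le_one_right h3 (Real.cos_le_one (ρ * (y - a)))
    have h6 := mul_le_of_le_one_left h4 (Real.cos_le_one (ρ * (b - y)))
    nlinarith
  gcongr

theorem norm_inv_exp_div_le {m : ℕ} (hm : 1 ≤ m) {w : ℂ} {d t : ℝ}
    (h : ‖Complex.exp (-w)‖ ≤ Real.exp (-d * t)) :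
    ‖(Complex.exp (w / m))⁻¹‖ ≤ Real.exp (-(d / m) * t) := by
  have hm0 : m ≠ 0 := by omega
  have hmC : (m : ℂ) ≠ 0 := by exact_mod_cast hm0
  have hmR : (m : ℝ) ≠ 0 := by exact_mod_cast hm0
  rw [← pow_le_pow_iff_left₀ (norm_nonneg _) (Real.exp_pos _).le hm0, ← Complex.exp_neg,
    ← norm_pow, ← Complex.exp_nat_mul, ← Real.exp_nat_mul]
  have h1 : (m : ℂ) * -(w / m) = -w := by field_simp
  have h2 : (m : ℝ) * (-(d / m) * t) = -d * t := by field_simp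
  rwa [h1, h2]

/-- Where `exp (-p)` decays, `φ` follows one branch of `exp (p / m)` up to an exponentially small
error. -/
theorem exists_root_rayLe {α β r₀ ρ a b d : ℝ} {m : ℕ} {φ p : ℂ → ℂ} {c : ℕ → ℂ → ℂ} (hρ : 0 < ρ)
    (hm : 1 ≤ m) (hφ : DifferentiableOn ℂ φ (logSector α β r₀))
    (hp : DifferentiableOn ℂ p (logSector α β r₀))
    (hc : ∀ j < m - 1, StripFinite α β r₀ ρ (c j))
    (hslow : ∀ j < m - 1, ∀ θ, α < θ → θ < β → RaySlow (c j) ρ θ)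
    (heq : ∀ ζ ∈ logSector α β r₀,
      φ ζ ^ m + ∑ j ∈ Finset.range (m - 1), c j ζ * φ ζ ^ j = Complex.exp (p ζ))
    (hpf : StripFinite α β r₀ ρ fun ζ => Complex.exp (-p ζ))
    (ha : α < a) (hab : a < b) (hb : b < β) (hba : ρ * (b - a) < Real.pi) (hd : 0 < d)
    (hA : RayLe (fun ζ => Complex.exp (-p ζ)) ρ a (-d))
    (hB : RayLe (fun ζ => Complex.exp (-p ζ)) ρ b (-d)) :
    ∃ ω : ℂ, ω ^ m = 1 ∧ ∃ κ : ℝ, 0 < κ ∧ ∀ y ∈ Set.Icc a b,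
      RayLe (fun ζ => φ ζ - ω * Complex.exp (p ζ / m)) ρ y (-κ) := by
  have hmR : (0 : ℝ) < m := by exact_mod_cast hm
  have hmC : (m : ℂ) ≠ 0 := by exact_mod_cast hmR.ne'
  -- The decay rate of `E⁻¹`: `d / 2` is the uniform rate for `exp (-p)`, and `1 / m` comes from the
  -- root. With coefficients bounded at rate `κ / 4`, the error in `(φ / E) ^ m` has rate `2κ - κ /
  -- 4 = 7κ / 4`. Multiplying by `E` leaves `κ - κ / 4 = 3κ / 4`, and `κ / 2` absorbs the constants.
  set κ := d / 2 / m with hκ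
  have hκ0 : 0 < κ := by positivity
  have hdec := hpf.eventually_norm_le_of_decay hρ ha hab hb hba hd hA hB
  have hsl : ∀ᶠ x : ℝ in atTop, ∀ j ∈ Finset.range (m - 1), ∀ y ∈ Set.Icc a b,
      ‖c j ⟨x, y⟩‖ ≤ Real.exp (κ / 4 * Real.exp (ρ * x)) := by
    rw [eventually_all_finset]
    intro j hj
    have hj' := Finset.mem_range.1 hj
    exact (hc j hj').eventually_norm_le_of_slow hρ ha hab hb hba
      (hslow j hj' a ha (hab.trans hb)) (hslow j hj' b (ha.trans hab) hb) (by positivity)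
  have hsum : ∀ᶠ x : ℝ in atTop, ∀ y ∈ Set.Icc a b, (⟨x, y⟩ : ℂ) ∈ logSector α β r₀ ∧
      ‖(Complex.exp (p ⟨x, y⟩ / m))⁻¹‖ ≤ Real.exp (-κ * Real.exp (ρ * x)) ∧
      ∑ j ∈ Finset.range (m - 1), ‖c j ⟨x, y⟩‖ ≤ m * Real.exp (κ / 4 * Real.exp (ρ * x)) := by
    filter_upwards [hdec, hsl, Real.tendsto_exp_atTop.eventually_gt_atTop r₀] with x h1 h2 h3 y hy
    refine ⟨⟨h3, ha.trans_le hy.1, hy.2.trans_lt hb⟩, norm_inv_exp_div_le hm (h1 y hy), ?_⟩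
    refine (Finset.sum_le_sum fun j hj => h2 j hj y hy).trans ?_
    rw [Finset.sum_const, Finset.card_range, nsmul_eq_mul]
    gcongr
    exact Nat.sub_le _ _
  have hsmall := eventually_mul_exp_le (c := -(7 / 4 * κ)) (c' := 0) hρ (by linarith)
    (2 * 2 ^ m * m)
  obtain ⟨X, hX⟩ := eventually_atTop.1 (hsum.and hsmall)
  set D : Set ℂ := Set.Ici X ×ℂ Set.Icc a b with hD
  have hτ : ∀ x, X ≤ x → ∀ y ∈ Set.Icc a b,
      (∑ j ∈ Finset.range (m - 1), ‖c j ⟨x, y⟩‖) * ‖(Complex.exp (p ⟨x, y⟩ / m))⁻¹‖ ^ 2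
        ≤ m * Real.exp (-(7 / 4 * κ) * Real.exp (ρ * x)) := by
    intro x hx y hy
    obtain ⟨-, h1, h2⟩ := (hX x hx).1 y hy
    calc _ ≤ m * Real.exp (κ / 4 * Real.exp (ρ * x)) * Real.exp (-κ * Real.exp (ρ * x)) ^ 2 := by
          gcongr
      _ = _ := by rw [← Real.exp_nat_mul, mul_assoc, ← Real.exp_add]; push_cast; ring_nf
  have hsm : ∀ x, X ≤ x → 2 ^ m * (m * Real.exp (-(7 / 4 * κ) * Real.exp (ρ * x))) ≤ 1 / 2 := by
    intro x hx
    have := (hX x hx).2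
    rw [zero_mul, Real.exp_zero] at this
    linarith
  have hL : ∀ x, X ≤ x → ∀ y ∈ Set.Icc a b,
      ‖(φ ⟨x, y⟩ / Complex.exp (p ⟨x, y⟩ / m)) ^ m - 1‖ ≤ 2 ^ m *
        ((∑ j ∈ Finset.range (m - 1), ‖c j ⟨x, y⟩‖) * ‖(Complex.exp (p ⟨x, y⟩ / m))⁻¹‖ ^ 2) := by
    intro x hx y hy
    obtain ⟨h0, h1, h2⟩ := (hX x hx).1 y hy
    refine norm_div_pow_sub_one_le hm (Complex.exp_ne_zero _) ?_ (h1.trans ?_) ?_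
    · rw [heq _ h0, ← Complex.exp_nat_mul, mul_div_cancel₀ _ hmC]
    · rw [Real.exp_le_one_iff]
      have := mul_pos hκ0 (Real.exp_pos (ρ * x))
      linarith
    · refine (hτ x hx y hy).trans ?_
      have h4 := hsm x hx
      have h5 : (1 : ℝ) ≤ 2 ^ m := one_le_pow₀ (by norm_num)
      have h6 : 0 ≤ m * Real.exp (-(7 / 4 * κ) * Real.exp (ρ * x)) := by positivity
      nlinarith
  have hmemD : ∀ ζ ∈ D, ζ ∈ logSector α β r₀ := fun ζ hζ => ((hX ζ.re hζ.1).1 ζ.im hζ.2).1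
  have hDc : IsPreconnected D :=
    (((convex_Ici X).linear_preimage Complex.reLm).inter
      ((convex_Icc a b).linear_preimage Complex.imLm)).isPreconnected
  obtain ⟨ω, hω, hωL⟩ := exists_root_of_unity_near hm hDc
    (L := fun ζ => φ ζ / Complex.exp (p ζ / m))
    ((hφ.continuousOn.mono hmemD).div
      (Complex.continuous_exp.comp_continuousOn ((hp.continuousOn.mono hmemD).div_const _))
      fun ζ _ => Complex.exp_ne_zero _)
    (fun ζ hζ => ((hL ζ.re hζ.1 ζ.im hζ.2).trans
      (mul_le_mul_of_nonneg_left (hτ ζ.re hζ.1 ζ.im hζ.2) (by positivity))).trans (hsm ζ.re hζ.1))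
  refine ⟨ω, hω, κ / 2, by positivity, fun y hy => ?_⟩
  filter_upwards [eventually_ge_atTop X, eventually_mul_exp_le (c := -(3 / 4 * κ)) (c' := -(κ / 2))
    hρ (by linarith) (3 * (2 ^ m * m))] with x hx hx2
  refine le_trans ?_ hx2
  obtain ⟨h0, h1, h2⟩ := (hX x hx).1 y hy
  have h3 := (hωL ⟨x, y⟩ ⟨hx, hy⟩).trans (mul_le_mul_of_nonneg_left (hL x hx y hy) (by norm_num))
  set E := Complex.exp (p ⟨x, y⟩ / m) with hE
  have hE0 : E ≠ 0 := Complex.exp_ne_zero _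
  have h4 : φ ⟨x, y⟩ - ω * E = E * (φ ⟨x, y⟩ / E - ω) := by field_simp
  rw [h4, norm_mul]
  have h5 : ‖E‖ * ‖E⁻¹‖ = 1 := by rw [← norm_mul, mul_inv_cancel₀ hE0, norm_one]
  set s := ∑ j ∈ Finset.range (m - 1), ‖c j ⟨x, y⟩‖ with hs
  calc ‖E‖ * ‖φ ⟨x, y⟩ / E - ω‖ ≤ ‖E‖ * (3 * (2 ^ m * (s * ‖E⁻¹‖ ^ 2))) := by gcongr
    _ = 3 * 2 ^ m * (s * ‖E⁻¹‖) * (‖E‖ * ‖E⁻¹‖) := by ring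
    _ ≤ 3 * 2 ^ m * (m * Real.exp (κ / 4 * Real.exp (ρ * x)) * Real.exp (-κ * Real.exp (ρ * x))) := by
      rw [h5, mul_one]; gcongr
    _ = _ := by
      have : Real.exp (-(3 / 4 * κ) * Real.exp (ρ * x))
        = Real.exp (κ / 4 * Real.exp (ρ * x)) * Real.exp (-κ * Real.exp (ρ * x)) := by
        rw [← Real.exp_add]; ring_nf
      rw [this]; ring

/-! ### A priori bounds for the difference from a branch. -/

theorem norm_exp_div_le {m : ℕ} (hm : 1 ≤ m) (w : ℂ) :
    ‖Complex.exp (w / m)‖ ≤ 1 + ‖Complex.exp w‖ := by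
  have hmC : (m : ℂ) ≠ 0 := by exact_mod_cast (by omega : m ≠ 0)
  rcases le_total ‖Complex.exp (w / m)‖ 1 with h | h
  · linarith [norm_nonneg (Complex.exp w)]
  · have : ‖Complex.exp w‖ = ‖Complex.exp (w / m)‖ ^ m := by
      rw [← norm_pow, ← Complex.exp_nat_mul, mul_div_cancel₀ _ hmC]
    rw [this]
    linarith [le_self_pow₀ h (by omega : m ≠ 0)]

theorem norm_le_of_pow_add_sum_eq {m : ℕ} (hm : 1 ≤ m) {φ w : ℂ} {b : ℕ → ℂ}
    (h : φ ^ m + ∑ j ∈ Finset.range (m - 1), b j * φ ^ j = w) :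
    ‖φ‖ ≤ 1 + ‖w‖ + ∑ j ∈ Finset.range (m - 1), ‖b j‖ := by
  have hs : 0 ≤ ∑ j ∈ Finset.range (m - 1), ‖b j‖ := by positivity
  rcases le_total ‖φ‖ 1 with h1 | h1
  · linarith [norm_nonneg w]
  · have h2 : 1 ≤ ‖φ‖ ^ (m - 1) := one_le_pow₀ h1
    have h3 : ‖φ‖ ^ (m - 1) * ‖φ‖ ≤ ‖w‖ + (∑ j ∈ Finset.range (m - 1), ‖b j‖) * ‖φ‖ ^ (m - 1) := by
      rw [← pow_succ, Nat.sub_add_cancel hm, ← norm_pow, eq_sub_of_add_eq h, Finset.sum_mul]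
      refine (norm_sub_le _ _).trans ?_
      gcongr
      refine (norm_sum_le _ _).trans (Finset.sum_le_sum fun j hj => ?_)
      rw [norm_mul, norm_pow]
      exact mul_le_mul_of_nonneg_left
        (pow_le_pow_right₀ h1 (Finset.mem_range.1 hj).le) (norm_nonneg _)
    have h4 : ‖φ‖ ^ (m - 1) * ‖φ‖
        ≤ ‖φ‖ ^ (m - 1) * (‖w‖ + ∑ j ∈ Finset.range (m - 1), ‖b j‖) := by
      nlinarith [norm_nonneg w]
    have := le_of_mul_le_mul_left h4 (by positivity)
    linarith

/-- Through this bound the difference inherits finite order everywhere, and a nonpositive indicator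
wherever `exp p` is slow. -/
theorem norm_sub_mul_exp_div_le {m : ℕ} (hm : 1 ≤ m) {φ w ω : ℂ} {b : ℕ → ℂ} (hω : ω ^ m = 1)
    (h : φ ^ m + ∑ j ∈ Finset.range (m - 1), b j * φ ^ j = Complex.exp w) :
    ‖φ - ω * Complex.exp (w / m)‖
      ≤ 2 + 2 * ‖Complex.exp w‖ + ∑ j ∈ Finset.range (m - 1), ‖b j‖ := by
  have hn : ‖ω‖ = 1 := by
    have := congrArg norm hω
    rw [norm_pow, norm_one] at this
    exact (pow_eq_one_iff_of_nonneg (norm_nonneg _) (by omega)).1 this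
  have h1 := norm_sub_le φ (ω * Complex.exp (w / m))
  rw [norm_mul, hn, one_mul] at h1
  linarith [norm_le_of_pow_add_sum_eq hm h, norm_exp_div_le hm w]

theorem StripFinite.of_norm_le {α β r₀ ρ : ℝ} {n : ℕ} {F G : ℂ → ℂ} {c : ℕ → ℂ → ℂ}
    (hF : StripFinite α β r₀ ρ F) (hc : ∀ j < n, StripFinite α β r₀ ρ (c j))
    (hG : DifferentiableOn ℂ G (logSector α β r₀))
    (h : ∀ ζ ∈ logSector α β r₀, ‖G ζ‖ ≤ 2 + 2 * ‖F ζ‖ + ∑ j ∈ Finset.range n, ‖c j ζ‖) :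
    StripFinite α β r₀ ρ G := by
  refine ⟨hG, fun ρ' hρ' => ?_⟩
  obtain ⟨C, hC⟩ := hF.order ρ' hρ'
  choose! D hD using fun j (hj : j < n) => (hc j hj).order ρ' hρ'
  refine ⟨2 + 2 * C + ∑ j ∈ Finset.range n, D j, fun ζ hζ => (h ζ hζ).trans ?_⟩
  have h1 := hC ζ hζ
  have h2 : ∑ j ∈ Finset.range n, ‖c j ζ‖
      ≤ ∑ j ∈ Finset.range n, D j * Real.exp (Real.exp (ρ' * ζ.re)) :=
    Finset.sum_le_sum fun j hj => hD j (Finset.mem_range.1 hj) ζ hζ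
  have h3 : 1 ≤ Real.exp (Real.exp (ρ' * ζ.re)) := Real.one_le_exp (Real.exp_pos _).le
  rw [← Finset.sum_mul] at h2
  nlinarith

theorem RaySlow.of_norm_le {ρ θ : ℝ} {n : ℕ} {F G : ℂ → ℂ} {c : ℕ → ℂ → ℂ} (hρ : 0 < ρ)
    (hF : RaySlow F ρ θ) (hc : ∀ j < n, RaySlow (c j) ρ θ)
    (h : ∀ᶠ x : ℝ in atTop,
      ‖G ⟨x, θ⟩‖ ≤ 2 + 2 * ‖F ⟨x, θ⟩‖ + ∑ j ∈ Finset.range n, ‖c j ⟨x, θ⟩‖) :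
    RaySlow G ρ θ := by
  intro ε hε
  have hall : ∀ᶠ x : ℝ in atTop, ∀ j ∈ Finset.range n,
      ‖c j ⟨x, θ⟩‖ ≤ Real.exp (ε / 2 * Real.exp (ρ * x)) := by
    rw [eventually_all_finset]
    exact fun j hj => hc j (Finset.mem_range.1 hj) _ (half_pos hε)
  filter_upwards [h, hall, hF _ (half_pos hε), eventually_mul_exp_le hρ (half_lt_self hε) (4 + n)]
    with x h1 h2 h3 h4
  refine (h1.trans ?_).trans h4
  have h5 := Finset.sum_le_sum h2
  rw [Finset.sum_const, Finset.card_range, nsmul_eq_mul] at h5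
  have h6 : 1 ≤ Real.exp (ε / 2 * Real.exp (ρ * x)) := Real.one_le_exp (by positivity)
  nlinarith

/-! ### The main argument in logarithmic coordinates. -/

/-- If `exp p` is slow on the closed interval's ends, it cannot grow exponentially between them
when the interval is shorter than `π / ρ`. -/
theorem not_decay_between {α β r₀ ρ a b y d : ℝ} {p : ℂ → ℂ} (hρ : 0 < ρ)
    (hpe : StripFinite α β r₀ ρ fun ζ => Complex.exp (p ζ))
    (ha : α < a) (hb : b < β) (hba : ρ * (b - a) < Real.pi)
    (hA : RaySlow (fun ζ => Complex.exp (p ζ)) ρ a) (hB : RaySlow (fun ζ => Complex.exp (p ζ)) ρ b)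
    (hy : y ∈ Set.Ioo a b) (hd : 0 < d) (hdec : RayLe (fun ζ => Complex.exp (-p ζ)) ρ y (-d)) :
    False := by
  obtain ⟨x, h1, h2⟩ := ((hpe.eventually_norm_le_of_slow hρ ha (hy.1.trans hy.2) hb hba hA hB
    (half_pos hd)).and hdec).exists
  have h3 := mul_le_mul (h1 y ⟨hy.1.le, hy.2.le⟩) h2 (norm_nonneg _) (Real.exp_pos _).le
  rw [← norm_mul, ← Complex.exp_add, ← Real.exp_add, add_neg_cancel, Complex.exp_zero, norm_one,
    Real.one_le_exp_iff] at h3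
  nlinarith [mul_pos hd (Real.exp_pos (ρ * x))]

/-- Both approximations force `(ω - ω') * E` to stay bounded along a ray on which `E` tends to
infinity. -/
theorem eq_of_rayLe_sub {ρ θ d κ κ' : ℝ} {m : ℕ} (hm : 1 ≤ m) {φ p : ℂ → ℂ} {ω ω' : ℂ} (hρ : 0 < ρ)
    (hd : 0 < d) (hκ : 0 < κ) (hκ' : 0 < κ')
    (hdec : RayLe (fun ζ => Complex.exp (-p ζ)) ρ θ (-d))
    (h : RayLe (fun ζ => φ ζ - ω * Complex.exp (p ζ / m)) ρ θ (-κ))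
    (h' : RayLe (fun ζ => φ ζ - ω' * Complex.exp (p ζ / m)) ρ θ (-κ')) : ω = ω' := by
  have hbd : ∀ᶠ x : ℝ in atTop, ‖ω - ω'‖ ≤ 2 * Real.exp (-(d / m) * Real.exp (ρ * x)) := by
    filter_upwards [hdec, h, h'] with x h1 h2 h3
    have h4 := norm_inv_exp_div_le hm h1
    set E := Complex.exp (p ⟨x, θ⟩ / m) with hE
    have hE0 : E ≠ 0 := Complex.exp_ne_zero _
    have h5 : ∀ {k : ℝ}, 0 < k → Real.exp (-k * Real.exp (ρ * x)) ≤ 1 := fun {k} hk => by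
      rw [Real.exp_le_one_iff]
      have := mul_pos hk (Real.exp_pos (ρ * x))
      linarith
    have h6 : ω - ω' = ((φ ⟨x, θ⟩ - ω' * E) - (φ ⟨x, θ⟩ - ω * E)) * E⁻¹ := by field_simp; ring
    rw [h6, norm_mul]
    have h7 := (norm_sub_le (φ ⟨x, θ⟩ - ω' * E) (φ ⟨x, θ⟩ - ω * E)).trans
      (add_le_add (h3.trans (h5 hκ')) (h2.trans (h5 hκ)))
    rw [one_add_one_eq_two] at h7
    exact mul_le_mul h7 h4 (norm_nonneg _) (by norm_num)
  have hdm : 0 < d / m := div_pos hd (by exact_mod_cast hm)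
  have hlim : Tendsto (fun x : ℝ => 2 * Real.exp (-(d / m) * Real.exp (ρ * x))) atTop
      (nhds (2 * 0)) := (Real.tendsto_exp_atBot.comp
    ((tendsto_exp_mul_atTop hρ).const_mul_atTop_of_neg (neg_neg_of_pos hdm))).const_mul 2
  rw [mul_zero] at hlim
  have := ge_of_tendsto hlim hbd
  exact sub_eq_zero.1 (norm_le_zero_iff.1 this)

/-- In logarithmic coordinates: if `φ ^ m + ∑ j < m - 1, c j * φ ^ j = exp p` with slow `c j` and
`exp p` has almost sinusoidal indicator, then `φ` is a branch of `exp (p / m)` and every `c j`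
vanishes. -/
theorem eq_branch_and_coeff_eq_zero {α β r₀ ρ α₁ β₁ : ℝ} {m : ℕ} {φ p : ℂ → ℂ} {c : ℕ → ℂ → ℂ}
    (hρ : 0 < ρ) (hαβ : Real.pi / ρ < β - α)
    (hm : 1 ≤ m) (hφ : DifferentiableOn ℂ φ (logSector α β r₀))
    (hp : DifferentiableOn ℂ p (logSector α β r₀))
    (hc : ∀ j < m - 1, StripFinite α β r₀ ρ (c j))
    (hslow : ∀ j < m - 1, ∀ θ, α < θ → θ < β → RaySlow (c j) ρ θ)
    (heq : ∀ ζ ∈ logSector α β r₀,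
      φ ζ ^ m + ∑ j ∈ Finset.range (m - 1), c j ζ * φ ζ ^ j = Complex.exp (p ζ))
    (hpe : StripFinite α β r₀ ρ fun ζ => Complex.exp (p ζ))
    (hpf : StripFinite α β r₀ ρ fun ζ => Complex.exp (-p ζ))
    (h₁ : α₁ < β₁) (hα₁ : α ≤ α₁) (hβ₁ : β₁ ≤ β)
    (hdec : ∀ θ ∈ Set.Ioo α₁ β₁, ∃ d : ℝ, 0 < d ∧ RayLe (fun ζ => Complex.exp (-p ζ)) ρ θ (-d))
    (hout : ∀ θ ∈ Set.Ioo α β \ Set.Ioo α₁ β₁, RaySlow (fun ζ => Complex.exp (p ζ)) ρ θ) :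
    ∃ ω : ℂ, ω ^ m = 1 ∧ (∀ ζ ∈ logSector α β r₀, φ ζ = ω * Complex.exp (p ζ / m)) ∧
      ∀ j < m - 1, ∀ ζ ∈ logSector α β r₀, c j ζ = 0 := by
  have hρπ : ρ * (Real.pi / ρ) = Real.pi := by field_simp
  have hπ : 0 < Real.pi / ρ := div_pos Real.pi_pos hρ
  have hneg : ∀ {d : ℝ}, 0 < d → ∀ {ε : ℝ}, 0 < ε → -d ≤ ε := fun h _ h' => by linarith
  -- On a wider interval uniqueness, applied to `exp (-p)` inside `(α₁, β₁)`, would make that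
  -- exponential vanish.
  have hwidth : β₁ - α₁ ≤ Real.pi / ρ := by
    by_contra! hlt
    obtain ⟨θ, hθ1, hθ2⟩ := exists_between (lt_sub_iff_add_lt'.1 hlt |> lt_sub_iff_add_lt.2)
    obtain ⟨d, hd, hdd⟩ := hdec θ ⟨hθ1, by linarith⟩
    have hz := (hpf.mono hα₁ hβ₁).eqOn_zero hρ (fun t ht1 ht2 ε hε => by
      obtain ⟨e, he, hee⟩ := hdec t ⟨ht1, ht2⟩
      exact hee.mono (hneg he hε)) hθ1 (by linarith) (Or.inl (by linarith)) hd hdd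
    obtain ⟨x, hx⟩ := (Real.tendsto_exp_atTop.eventually_gt_atTop r₀).exists
    exact Complex.exp_ne_zero _ (hz (x := ⟨x, θ⟩) ⟨hx, hθ1, by linarith⟩)
  -- Otherwise `β - π / ρ ≤ α₁` and `β₁ ≤ α + π / ρ`. Then `α₁` and `β₁` lie inside `(α, β)` at
  -- distance less than `π / ρ`, and `exp p` is slow at both, which excludes growth between them.
  have hθ₀ : ∃ θ₀ ∈ Set.Ioo α₁ β₁, θ₀ + Real.pi / ρ < β ∨ α < θ₀ - Real.pi / ρ := by
    by_contra! hno
    have e1 : β ≤ α₁ + Real.pi / ρ := by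
      by_contra! hlt
      obtain ⟨θ, hθ1, hθ2⟩ := exists_between (lt_min h₁ (lt_sub_iff_add_lt.2 hlt))
      have := (hno θ ⟨hθ1, hθ2.trans_le (min_le_left _ _)⟩).1
      linarith [hθ2.trans_le (min_le_right _ _)]
    have e2 : β₁ - Real.pi / ρ ≤ α := by
      by_contra! hlt
      obtain ⟨θ, hθ1, hθ2⟩ := exists_between (max_lt h₁ (lt_sub_iff_add_lt.1 hlt))
      have := (hno θ ⟨(le_max_left _ _).trans_lt hθ1, hθ2⟩).2
      linarith [(le_max_right _ _).trans_lt hθ1]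
    obtain ⟨θ, hθ⟩ := exists_between h₁
    obtain ⟨d, hd, hdd⟩ := hdec θ hθ
    refine not_decay_between hρ hpe (a := α₁) (b := β₁) (by linarith) (by linarith) ?_
      (hout α₁ ⟨⟨by linarith, by linarith⟩, fun h => lt_irrefl _ h.1⟩)
      (hout β₁ ⟨⟨by linarith, by linarith⟩, fun h => lt_irrefl _ h.2⟩) hθ hd hdd
    calc ρ * (β₁ - α₁) < ρ * (Real.pi / ρ) := by gcongr; linarith
      _ = Real.pi := hρπ
  obtain ⟨θ₀, hθ₀, hwide⟩ := hθ₀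
  obtain ⟨d₀, hd₀, hdec₀⟩ := hdec θ₀ hθ₀
  have hroot : ∀ a b, a < b → a ∈ Set.Ioo α₁ β₁ → b ∈ Set.Ioo α₁ β₁ → ∃ ω : ℂ, ω ^ m = 1 ∧
      ∃ κ : ℝ, 0 < κ ∧ ∀ y ∈ Set.Icc a b,
        RayLe (fun ζ => φ ζ - ω * Complex.exp (p ζ / m)) ρ y (-κ) := by
    intro a b hab ha hb
    obtain ⟨d, hd, hdd⟩ := hdec a ha
    obtain ⟨e, he, hee⟩ := hdec b hb
    refine exists_root_rayLe (d := min d e) hρ hm hφ hp hc hslow heq hpf (hα₁.trans_lt ha.1) hab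
      (hb.2.trans_le hβ₁) ?_ (lt_min hd he) (hdd.mono (neg_le_neg (min_le_left _ _)))
      (hee.mono (neg_le_neg (min_le_right _ _)))
    calc ρ * (b - a) < ρ * (Real.pi / ρ) := by gcongr; linarith [ha.1, hb.2]
      _ = Real.pi := hρπ
  obtain ⟨θ₁, hθ₁⟩ := exists_between hθ₀.2
  obtain ⟨ω, hω, κ, hκ, hωκ⟩ := hroot θ₀ θ₁ hθ₁.1 hθ₀ ⟨hθ₀.1.trans hθ₁.1, hθ₁.2⟩
  have hg₀ := hωκ θ₀ ⟨le_rfl, hθ₁.1.le⟩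
  -- The root `ω'` found on another subinterval agrees with `ω`, because both subintervals contain
  -- `θ₀`.
  have hgdec : ∀ θ ∈ Set.Ioo α₁ β₁, ∃ κ : ℝ, 0 < κ ∧
      RayLe (fun ζ => φ ζ - ω * Complex.exp (p ζ / m)) ρ θ (-κ) := by
    intro θ hθ
    rcases lt_trichotomy θ θ₀ with h | h | h
    · obtain ⟨ω', hω', κ', hκ', hh⟩ := hroot θ θ₀ h hθ hθ₀
      rw [eq_of_rayLe_sub hm hρ hd₀ hκ hκ' hdec₀ hg₀ (hh θ₀ ⟨h.le, le_rfl⟩)]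
      exact ⟨κ', hκ', hh θ ⟨le_rfl, h.le⟩⟩
    · exact ⟨κ, hκ, h ▸ hg₀⟩
    · obtain ⟨ω', hω', κ', hκ', hh⟩ := hroot θ₀ θ h hθ₀ hθ
      rw [eq_of_rayLe_sub hm hρ hd₀ hκ hκ' hdec₀ hg₀ (hh θ₀ ⟨le_rfl, h.le⟩)]
      exact ⟨κ', hκ', hh θ ⟨h.le, le_rfl⟩⟩
  have hnorm : ∀ ζ ∈ logSector α β r₀, ‖φ ζ - ω * Complex.exp (p ζ / m)‖
      ≤ 2 + 2 * ‖Complex.exp (p ζ)‖ + ∑ j ∈ Finset.range (m - 1), ‖c j ζ‖ := fun ζ hζ =>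
    norm_sub_mul_exp_div_le hm hω (heq ζ hζ)
  have hgfin : StripFinite α β r₀ ρ fun ζ => φ ζ - ω * Complex.exp (p ζ / m) :=
    hpe.of_norm_le hc (hφ.sub ((hp.div_const _).cexp.const_mul _)) hnorm
  have hgslow : ∀ θ, α < θ → θ < β → RaySlow (fun ζ => φ ζ - ω * Complex.exp (p ζ / m)) ρ θ := by
    intro θ h1 h2
    by_cases hθ : θ ∈ Set.Ioo α₁ β₁
    · obtain ⟨κ', hκ', h⟩ := hgdec θ hθ
      exact fun ε hε => h.mono (hneg hκ' hε)
    · refine (hout θ ⟨⟨h1, h2⟩, hθ⟩).of_norm_le hρ (fun j hj => hslow j hj θ h1 h2) ?_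
      filter_upwards [Real.tendsto_exp_atTop.eventually_gt_atTop r₀] with x hx
      exact hnorm _ ⟨hx, h1, h2⟩
  have hα₀ : α < θ₀ := hα₁.trans_lt hθ₀.1
  have hβ₀ : θ₀ < β := hθ₀.2.trans_le hβ₁
  have hbranch : ∀ ζ ∈ logSector α β r₀, φ ζ = ω * Complex.exp (p ζ / m) := fun ζ hζ =>
    sub_eq_zero.1 (hgfin.eqOn_zero hρ hgslow hα₀ hβ₀ hwide hκ hg₀ hζ)
  refine ⟨ω, hω, hbranch, ?_⟩
  have hmR : (0 : ℝ) < m := by exact_mod_cast hm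
  have hmC : (m : ℂ) ≠ 0 := by exact_mod_cast hmR.ne'
  have hωn : ‖ω‖ = 1 := by
    have := congrArg norm hω
    rw [norm_pow, norm_one] at this
    exact (pow_eq_one_iff_of_nonneg (norm_nonneg _) (by omega)).1 this
  have hsum0 : ∀ ζ ∈ logSector α β r₀, ∑ j ∈ Finset.range (m - 1), c j ζ * φ ζ ^ j = 0 := by
    intro ζ hζ
    have h1 := heq ζ hζ
    have h2 : φ ζ ^ m = Complex.exp (p ζ) := by
      rw [hbranch ζ hζ, mul_pow, hω, one_mul, ← Complex.exp_nat_mul, mul_div_cancel₀ _ hmC]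
    rw [h2] at h1
    exact left_eq_add.1 h1.symm
  -- Descending elimination: the top coefficient is shown to vanish and is then removed from the
  -- relation.
  suffices H : ∀ k ≤ m - 1, (∀ ζ ∈ logSector α β r₀,
      ∑ j ∈ Finset.range k, c j ζ * φ ζ ^ j = 0) →
      ∀ j < k, ∀ ζ ∈ logSector α β r₀, c j ζ = 0 from H (m - 1) le_rfl hsum0
  intro k
  induction k with
  | zero => exact fun _ _ j hj => absurd hj (Nat.not_lt_zero j)
  | succ k ih =>
    intro hk hs
    have hk' : k < m - 1 := hk
    set κ₀ := d₀ / m with hκ₀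
    have hκ₀0 : 0 < κ₀ := by positivity
    have hall : ∀ᶠ x : ℝ in atTop, ∀ j ∈ Finset.range k,
        ‖c j ⟨x, θ₀⟩‖ ≤ Real.exp (κ₀ / 4 * Real.exp (ρ * x)) := by
      rw [eventually_all_finset]
      exact fun j hj => hslow j ((Finset.mem_range.1 hj).trans hk') θ₀ hα₀ hβ₀ _ (by positivity)
    have hckdec : RayLe (c k) ρ θ₀ (-(κ₀ / 2)) := by
      filter_upwards [hdec₀, hall, Real.tendsto_exp_atTop.eventually_gt_atTop r₀,
        eventually_mul_exp_le (c := -(3 / 4 * κ₀)) (c' := -(κ₀ / 2)) hρ (by linarith) k]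
        with x h1 h2 h3 h4
      have hmem : (⟨x, θ₀⟩ : ℂ) ∈ logSector α β r₀ := ⟨h3, hα₀, hβ₀⟩
      have h5 := norm_inv_exp_div_le hm h1
      rw [← hκ₀] at h5
      set E := Complex.exp (p ⟨x, θ₀⟩ / m) with hE
      have h6 : ‖φ ⟨x, θ₀⟩‖ = ‖E‖ := by rw [hbranch _ hmem, norm_mul, hωn, one_mul]
      have hE0 : 0 < ‖E‖ := norm_pos_iff.2 (Complex.exp_ne_zero _)
      have h7 : ‖E⁻¹‖ ≤ 1 := h5.trans (by
        rw [Real.exp_le_one_iff]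
        have := mul_pos hκ₀0 (Real.exp_pos (ρ * x))
        linarith)
      have h8 : 1 ≤ ‖E‖ := by
        rw [norm_inv] at h7
        exact (inv_le_one₀ hE0).1 h7
      -- Solve the relation for the top term and divide by `|E| ^ (k + 1)`; since `|φ| = |E| ≥ 1`,
      -- each lower term is at most `‖c j‖` after division.
      have h9 : ‖c k ⟨x, θ₀⟩‖ ≤ (∑ j ∈ Finset.range k, ‖c j ⟨x, θ₀⟩‖) * ‖E⁻¹‖ := by
        have h10 := hs _ hmem
        rw [Finset.sum_range_succ] at h10
        have h11 : ‖c k ⟨x, θ₀⟩‖ * ‖E‖ ^ k ≤ ∑ j ∈ Finset.range k, ‖c j ⟨x, θ₀⟩‖ * ‖E‖ ^ j := by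
          rw [← h6, ← norm_pow, ← norm_mul, eq_neg_of_add_eq_zero_right h10, norm_neg]
          refine (norm_sum_le _ _).trans (Finset.sum_le_sum fun j _ => ?_)
          rw [norm_mul, norm_pow]
        rw [norm_inv, ← div_eq_mul_inv, le_div_iff₀ hE0]
        refine le_of_mul_le_mul_right ?_ (pow_pos hE0 k)
        calc ‖c k ⟨x, θ₀⟩‖ * ‖E‖ * ‖E‖ ^ k = ‖c k ⟨x, θ₀⟩‖ * ‖E‖ ^ k * ‖E‖ := by ring
          _ ≤ (∑ j ∈ Finset.range k, ‖c j ⟨x, θ₀⟩‖ * ‖E‖ ^ j) * ‖E‖ := by gcongr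
          _ ≤ _ := by
            rw [Finset.sum_mul, Finset.sum_mul]
            refine Finset.sum_le_sum fun j hj => ?_
            rw [mul_assoc, ← pow_succ]
            exact mul_le_mul_of_nonneg_left
              (pow_le_pow_right₀ h8 (Finset.mem_range.1 hj)) (norm_nonneg _)
      have h10 := Finset.sum_le_sum h2
      rw [Finset.sum_const, Finset.card_range, nsmul_eq_mul] at h10
      refine (h9.trans (mul_le_mul h10 h5 (norm_nonneg _) (by positivity))).trans
        (le_trans (le_of_eq ?_) h4)
      rw [mul_assoc, ← Real.exp_add]; ring_nf
    have hck := (hc k hk').eqOn_zero hρ (hslow k hk') hα₀ hβ₀ hwide (half_pos hκ₀0) hckdec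
    intro j hj ζ hζ
    rcases (Nat.lt_succ_iff_lt_or_eq.1 hj) with h | h
    · refine ih (by omega) (fun ξ hξ => ?_) j h ζ hζ
      have := hs ξ hξ
      rwa [Finset.sum_range_succ, hck hξ, Pi.zero_apply, zero_mul, add_zero] at this
    · rw [h]; exact hck hζ

/-! ### Transfer between the angle and the half-strip. -/

theorem exp_mem_sector {α β r₀ : ℝ} {ζ : ℂ} (hζ : ζ ∈ logSector α β r₀) :
    Complex.exp ζ ∈ sector α β r₀ := by
  refine ⟨Real.exp ζ.re, ζ.im, hζ.1, hζ.2.1, hζ.2.2, ?_⟩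
  rw [Complex.ofReal_exp, ← Complex.exp_add, Complex.re_add_im]

theorem exists_exp_eq {α β r₀ : ℝ} (hr₀ : 0 ≤ r₀) (z : sector α β r₀) :
    ∃ ζ ∈ logSector α β r₀, Complex.exp ζ = z := by
  obtain ⟨z, r, θ, hr, h1, h2, rfl⟩ := z
  have hr' : 0 < r := hr₀.trans_lt hr
  refine ⟨(Real.log r : ℂ) + θ * Complex.I, ⟨?_, ?_, ?_⟩, ?_⟩
  · simpa [Real.exp_log hr'] using hr
  · simpa using h1
  · simpa using h2
  · rw [Complex.exp_add, ← Complex.ofReal_exp, Real.exp_log hr']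

/-- A function on the angle, in logarithmic coordinates. -/
noncomputable def logLift {S : Set ℂ} (f : S → ℂ) (ζ : ℂ) : ℂ := extend f (Complex.exp ζ)

theorem logLift_apply {α β r₀ : ℝ} (f : sector α β r₀ → ℂ) {ζ : ℂ} (hζ : ζ ∈ logSector α β r₀) :
    logLift f ζ = f ⟨Complex.exp ζ, exp_mem_sector hζ⟩ :=
  extend_apply f ⟨_, exp_mem_sector hζ⟩

theorem differentiableOn_logLift {α β r₀ : ℝ} {f : sector α β r₀ → ℂ} (hf : IsHolomorphic f) :
    DifferentiableOn ℂ (logLift f) (logSector α β r₀) :=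
  DifferentiableOn.comp hf Complex.differentiable_exp.differentiableOn fun _ hζ => exp_mem_sector hζ

theorem stripFinite_of_orderAtMost {α β r₀ ρ : ℝ} {f : sector α β r₀ → ℂ} {F : ℂ → ℂ}
    (hF : DifferentiableOn ℂ F (logSector α β r₀)) (hf : OrderAtMost f ρ)
    (h : ∀ ζ ∈ logSector α β r₀, F ζ = logLift f ζ) : StripFinite α β r₀ ρ F := by
  refine ⟨hF, fun ρ' hρ' => ?_⟩
  obtain ⟨C, hC⟩ := hf ρ' hρ'
  refine ⟨C, fun ζ hζ => ?_⟩
  rw [h ζ hζ, logLift_apply f hζ]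
  refine (hC _).trans_eq ?_
  rw [Complex.norm_exp, ← Real.exp_mul, mul_comm ζ.re]

theorem rayLe_of_indicator_lt {α β r₀ ρ θ c : ℝ} {f : sector α β r₀ → ℂ} {F : ℂ → ℂ}
    (hα : α < θ) (hβ : θ < β)
    (h : ∀ ζ ∈ logSector α β r₀, F ζ = logLift f ζ) (hi : indicator f ρ θ < (c : EReal)) :
    RayLe F ρ θ c := by
  have h1 := Real.tendsto_exp_atTop.eventually (eventually_lt_of_limsup_lt hi)
  filter_upwards [h1, Real.tendsto_exp_atTop.eventually_gt_atTop r₀] with x hx hx0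
  have e : ((Real.exp x : ℝ) : ℂ) * Complex.exp ((θ : ℂ) * Complex.I)
      = Complex.exp (⟨x, θ⟩ : ℂ) := by
    rw [Complex.ofReal_exp, ← Complex.exp_add, ← Complex.mk_eq_add_mul_I]
  rw [e] at hx
  rw [h ⟨x, θ⟩ ⟨hx0, hα, hβ⟩, logLift]
  have hp : (0 : ℝ) < Real.exp x ^ ρ := Real.rpow_pos_of_pos (Real.exp_pos x) ρ
  have hx' := hx.le
  rwa [EReal.div_le_iff_le_mul (by exact_mod_cast hp) (EReal.coe_ne_top _), ← EReal.coe_mul,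
    ← EReal.log_exp ((Real.exp x ^ ρ * c : ℝ) : EReal), ENNReal.log_le_log_iff, EReal.exp_coe,
    ← ofReal_norm, ENNReal.ofReal_le_ofReal_iff (Real.exp_pos _).le, mul_comm, ← Real.exp_mul,
    mul_comm x] at hx'

theorem raySlow_of_indicator_nonpos {α β r₀ ρ θ : ℝ} {f : sector α β r₀ → ℂ} {F : ℂ → ℂ}
    (hα : α < θ) (hβ : θ < β)
    (h : ∀ ζ ∈ logSector α β r₀, F ζ = logLift f ζ) (hi : indicator f ρ θ ≤ 0) :
    RaySlow F ρ θ := fun _ hε =>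
  rayLe_of_indicator_lt hα hβ h (hi.trans_lt (by exact_mod_cast hε))

theorem exists_rayLe_of_indicator_neg {α β r₀ ρ θ : ℝ} {f : sector α β r₀ → ℂ} {F : ℂ → ℂ}
    (hα : α < θ) (hβ : θ < β)
    (h : ∀ ζ ∈ logSector α β r₀, F ζ = logLift f ζ) (hi : indicator f ρ θ < 0) :
    ∃ d : ℝ, 0 < d ∧ RayLe F ρ θ (-d) := by
  obtain ⟨c, hc1, hc2⟩ := EReal.lt_iff_exists_real_btwn.1 hi
  refine ⟨-c, neg_pos.2 (by exact_mod_cast hc2), ?_⟩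
  rw [neg_neg]
  exact rayLe_of_indicator_lt hα hβ h hc1

/-- The translate of a monic polynomial of degree `m` that kills its coefficient of degree
`m - 1`. -/
theorem coeff_taylor_neg_eq_zero {R : Type*} [CommRing R] {P : Polynomial R} {m : ℕ} {q : R}
    (hm : 1 ≤ m) (hP : P.Monic) (hdeg : P.natDegree = m) (hq : (m : R) * q = P.coeff (m - 1)) :
    (Polynomial.taylor (-q) P).coeff (m - 1) = 0 := by
  have h1 : (Polynomial.hasseDeriv (m - 1) P).natDegree < 2 := by
    have := Polynomial.natDegree_hasseDeriv_le P (m - 1)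
    omega
  have h2 : P.coeff m = 1 := hdeg ▸ hP.coeff_natDegree
  have h3 : 1 + (m - 1) = m := by omega
  have h4 : m.choose (m - 1) = m := by
    rw [← Nat.choose_symm (by omega : m - 1 ≤ m), Nat.sub_sub_self hm, Nat.choose_one_right]
  rw [Polynomial.taylor_coeff, Polynomial.eval_eq_sum_range' h1]
  simp only [Finset.sum_range_succ, Finset.sum_range_zero, Polynomial.hasseDeriv_coeff, h3, h4, h2,
    zero_add, Nat.choose_self, pow_zero, pow_one, Nat.cast_one, one_mul, mul_one]
  rw [← hq]; ring

end AngleEq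

/-! ### Reduction of the theorem to logarithmic coordinates. -/

theorem theorem3p1 (α β r₀ ρ : ℝ) (hr₀ : 0 ≤ r₀) (hρ : 0 < ρ) (hαβ : Real.pi / ρ < β - α)
    (B : Subalgebra ℂ (AngleEq.sector α β r₀ → ℂ)) (hB : B ≤ AngleEq.slowAlgebra α β r₀ ρ hρ)
    (m : ℕ) (hm : 1 ≤ m) (P : Polynomial B) (hP : P.Monic) (hdeg : P.natDegree = m)
    (f p : AngleEq.sector α β r₀ → ℂ)
    (hf : AngleEq.IsHolomorphic f) (hp : AngleEq.IsHolomorphic p)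
    (heq : ∀ z, Polynomial.aeval f P z = Complex.exp (p z))
    (hsin : AngleEq.AlmostSinusoidal ρ p) :
    ∃ q : B, P = (Polynomial.X + Polynomial.C q) ^ m ∧
      ∃ ε : ℂ, ε ^ m = 1 ∧
        ∀ z, f z = ε * Complex.exp (p z / (m : ℂ)) - (q : AngleEq.sector α β r₀ → ℂ) z := by
  open AngleEq in
  have hmC : (m : ℂ) ≠ 0 := by exact_mod_cast (by omega : m ≠ 0)
  -- As `B` is a complex algebra, division by `m` stays in `B`; translating by `-q` removes the
  -- coefficient of degree `m - 1`.
  set q : B := (m : ℂ)⁻¹ • P.coeff (m - 1) with hq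
  have hmq : (m : B) * q = P.coeff (m - 1) := by
    rw [hq, ← nsmul_eq_mul, ← Nat.cast_smul_eq_nsmul ℂ, smul_smul, mul_inv_cancel₀ hmC, one_smul]
  set Q := Polynomial.taylor (-q) P with hQ
  have hQdeg : Q.natDegree = m := by rw [hQ, Polynomial.natDegree_taylor, hdeg]
  have hQm : Q.coeff m = 1 := by
    have h := Polynomial.leadingCoeff_taylor (-q) P
    rw [← hQ, Polynomial.leadingCoeff, hQdeg] at h
    rw [h, hP.leadingCoeff]
  have hQm1 : Q.coeff (m - 1) = 0 := coeff_taylor_neg_eq_zero hm hP hdeg hmq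
  have hPQ : P = Polynomial.taylor q Q := by
    rw [hQ, Polynomial.taylor_taylor, add_neg_cancel, Polynomial.taylor_zero]
  set g : sector α β r₀ → ℂ := f + (q : sector α β r₀ → ℂ) with hg
  have hQg : ∀ z, g z ^ m
      + ∑ j ∈ Finset.range (m - 1), (Q.coeff j : sector α β r₀ → ℂ) z * g z ^ j
      = Complex.exp (p z) := by
    intro z
    have h1 : Polynomial.aeval g Q = Polynomial.aeval f P := by
      rw [hQ, Polynomial.taylor_apply, Polynomial.aeval_comp]
      congr 2
      rw [map_add, Polynomial.aeval_X, Polynomial.aeval_C, map_neg, hg]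
      exact add_neg_cancel_right f (q : sector α β r₀ → ℂ)
    rw [← heq z, ← h1, Polynomial.aeval_eq_sum_range, hQdeg, Finset.sum_range_succ, hQm,
      ← Nat.sub_add_cancel hm, Finset.sum_range_succ, Nat.add_sub_cancel, hQm1, zero_smul,
      add_zero, one_smul, add_comm, Pi.add_apply, Pi.pow_apply, Finset.sum_apply]
    rfl
  have hslow : ∀ b : B, IsSlow ρ (b : sector α β r₀ → ℂ) := fun b => hB b.2
  have hpd := differentiableOn_logLift hp
  have hgd : DifferentiableOn ℂ (logLift g) (logSector α β r₀) := by
    refine ((differentiableOn_logLift hf).add (differentiableOn_logLift (hslow q).holo)).congr ?_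
    intro ζ hζ
    rw [Pi.add_apply, logLift_apply _ hζ, logLift_apply _ hζ, logLift_apply _ hζ, hg, Pi.add_apply]
  have hpe : ∀ ζ ∈ logSector α β r₀, Complex.exp (logLift p ζ)
      = logLift (fun z => Complex.exp (p z)) ζ := fun ζ hζ => by
    rw [logLift_apply _ hζ, logLift_apply _ hζ]
  have hpf : ∀ ζ ∈ logSector α β r₀, Complex.exp (-logLift p ζ)
      = logLift (fun z => Complex.exp (-p z)) ζ := fun ζ hζ => by
    rw [logLift_apply _ hζ, logLift_apply _ hζ]
  obtain ⟨ho1, ho2, α₁, β₁, h₁, hsub, hneg, hout⟩ := hsin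
  obtain ⟨hα₁, hβ₁⟩ := (Set.Ioo_subset_Ioo_iff h₁).1 hsub
  obtain ⟨ω, hω, hbr, hc0⟩ := eq_branch_and_coeff_eq_zero (r₀ := r₀) (φ := logLift g)
    (p := logLift p) (c := fun j => logLift (Q.coeff j : sector α β r₀ → ℂ)) hρ hαβ hm hgd hpd
    (fun j _ => stripFinite_of_orderAtMost (differentiableOn_logLift (hslow _).holo)
      (hslow _).order fun _ _ => rfl)
    (fun j _ θ h1 h2 => raySlow_of_indicator_nonpos h1 h2 (fun _ _ => rfl) ((hslow _).ind θ h1 h2))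
    (fun ζ hζ => by
      have := hQg ⟨_, exp_mem_sector hζ⟩
      simpa only [logLift_apply _ hζ] using this)
    (stripFinite_of_orderAtMost hpd.cexp ho1 hpe)
    (stripFinite_of_orderAtMost hpd.neg.cexp ho2 hpf) h₁ hα₁ hβ₁
    (fun θ hθ => exists_rayLe_of_indicator_neg (hsub hθ).1 (hsub hθ).2 hpf (hneg θ hθ))
    (fun θ hθ => raySlow_of_indicator_nonpos hθ.1.1 hθ.1.2 hpe (hout θ hθ))
  refine ⟨q, ?_, ω, hω, fun z => ?_⟩
  -- Coefficients below `m - 1` vanish by the analytic part, that of degree `m - 1` by the choice of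
  -- `q`; translating back gives `(X + C q) ^ m`.
  · have hQX : Q = Polynomial.X ^ m := by
      ext1 j
      rw [Polynomial.coeff_X_pow]
      split_ifs with hj
      · rw [hj, hQm]
      · rcases lt_or_gt_of_ne hj with h | h
        · rcases (Nat.le_sub_one_of_lt h).lt_or_eq with h' | h'
          · ext z
            obtain ⟨ζ, hζ, hz⟩ := exists_exp_eq hr₀ z
            have := hc0 j h' ζ hζ
            rw [logLift_apply _ hζ] at this
            have e : (⟨Complex.exp ζ, exp_mem_sector hζ⟩ : sector α β r₀) = z := Subtype.ext hz
            rwa [e] at this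
          · rw [h', hQm1]
        · exact Polynomial.coeff_eq_zero_of_natDegree_lt (hQdeg ▸ h)
    rw [hPQ, hQX, Polynomial.taylor_X_pow]
  · obtain ⟨ζ, hζ, hz⟩ := exists_exp_eq hr₀ z
    have h1 := hbr ζ hζ
    rw [logLift_apply _ hζ, logLift_apply _ hζ] at h1
    have e : (⟨Complex.exp ζ, exp_mem_sector hζ⟩ : sector α β r₀) = z := Subtype.ext hz
    rw [e, hg, Pi.add_apply] at h1
    exact eq_sub_of_add_eq h1
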